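/- Let $c_0\subseteq\mathbb R^{\mathbb N}$ be the space of real sequences converging to $0$; it is also regarded as a Banach space with the sup norm and unit vector basis $(e_k)_{k\ge 0}$. For a linear subspace $L\subseteq\mathbb R^{\mathbb N}$ let $\mathbb R^{\mathbb N}/L$ denote the equivalence relation on $\mathbb R^{\mathbb N}$ (with the product topology) given by $a\sim b\iff a-b\in L$. For a sequence $(x_n)_{n\ge 0}$ in a Banach space $X$ put $$\mathrm{coef}(X,(x_n))=\Big\{a\in\mathbb R^{\mathbb N}:\ \sum_{n=0}^{\infty}a(n)x_n\text{ converges in }X\Big\}.$$ For $m\ge 1$ let $e^i_k$ ($1\le i\le m$, $k\ge0$) be the $k$-th unit vector of the $i$-th summand of $\bigoplus_{i=1}^m c_0$ (sup norm; this space is isomorphic to $c_0$), put $x^m_{mj+i-1}=\sum_{k\le j}e^i_k$ for $1\le i\le m$, $j\ge 0$, and let $\mathrm{cs}^{(m)}=\mathrm{coef}\big(\bigoplus_{i=1}^m c_0,(x^m_n)\big)$. Fix a bijection $\langle\cdot,\cdot\rangle:\mathbb N^2\to\mathbb N$ such that $j\mapsto\langle i,j\rangle$ is strictly increasing for every $i$;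 let $e^i_k$ ($i,k\ge 0$) be the $k$-th unit vector of the $i$-th summand of $$\Big(\bigoplus_{i\in\mathbb N}c_0\Big)_0=\{(a_i)\in (c_0)^{\mathbb N}:\lim_{i\to\infty}\|a_i\|=0\}$$ (norm $\sup_i\|a_i\|$; this space is isomorphic to $c_0$), put $x^\infty_{\langle i,j\rangle}=\sum_{k\le j}e^i_k$, and let $\mathrm{cs}^{(\infty)}=\mathrm{coef}\big((\bigoplus_{i\in\mathbb N}c_0)_0,(x^\infty_n)\big)$. For equivalence relations $E$ on $X$ and $F$ on $Y$ ($X,Y$ Polish spaces), write $E\le_B F$ if there is a Borel function $\theta:X\to Y$ such that $x\mathrel{E}y\iff\theta(x)\mathrel{F}\theta(y)$ for all $x,y\in X$, and $E<_BF$ if $E\le_BF$ and $F\not\le_BE$. **Theorem.** For every $m\ge 1$: 1. $\mathbb R^{\mathbb N}/\mathrm{cs}^{(m)}\le_B\mathbb R^{\mathbb N}/\mathrm{cs}^{(m+1)}$; 2. $\mathbb R^{\mathbb N}/c_0<_B\mathbb R^{\mathbb N}/\mathrm{cs}^{(m)}<_B\mathbb R^{\mathbb N}/\mathrm{cs}^{(\infty)}$.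 -/

import Mathlib

open Filter Topology
open scoped ZeroAtInfty

/-- `E ≤_B F`: there is a Borel function `θ` with `E x y ↔ F (θ x) (θ y)`. -/
def BorelReducible {X Y : Type*} [TopologicalSpace X] [TopologicalSpace Y]
    (E : Setoid X) (F : Setoid Y) : Prop :=
  ∃ θ : X → Y, @Measurable X Y (borel X) (borel Y) θ ∧
    ∀ x y : X, E.r x y ↔ F.r (θ x) (θ y)

/-- `E <_B F`: `E ≤_B F` and not `F ≤_B E`. -/
def StrictBorelReducible {X Y : Type*} [TopologicalSpace X] [TopologicalSpace Y]
    (E : Setoid X) (F : Setoid Y) : Prop :=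
  BorelReducible E F ∧ ¬ BorelReducible F E

/-- The equivalence relation `ℝ^ℕ / L` on `ℝ^ℕ` (with the product topology), for a linear
subspace `L` of `ℝ^ℕ`: `a` and `b` are equivalent iff `a - b ∈ L`. -/
def quotRel (L : Submodule ℝ (ℕ → ℝ)) : Setoid (ℕ → ℝ) where
  r a b := a - b ∈ L
  iseqv :=
    { refl := fun a => by simp
      symm := fun {a b} h => by simpa using L.neg_mem h
      trans := fun {a b c} h₁ h₂ => by simpa using L.add_mem h₁ h₂ }

/-- The linear subspace `c₀` of `ℝ^ℕ`: the sequences that converge to `0`. -/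
def c0Seq : Submodule ℝ (ℕ → ℝ) where
  carrier := {a | Tendsto a atTop (𝓝 0)}
  zero_mem' := tendsto_const_nhds
  add_mem' {a b} ha hb := by
    have h := Tendsto.add (show Tendsto a atTop (𝓝 0) from ha)
      (show Tendsto b atTop (𝓝 0) from hb)
    rw [add_zero] at h
    exact h
  smul_mem' c a ha := by
    have h := Tendsto.const_smul (show Tendsto a atTop (𝓝 0) from ha) c
    rw [smul_zero] at h
    exact h

/-- `coef(X, (xₙ))`: the scalar sequences `a` for which the series `∑ₙ a(n) xₙ` converges
in the norm of `X` (convergence of the partial sums, not unconditional summability). -/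
def coef {X : Type*} [NormedAddCommGroup X] [NormedSpace ℝ X] (x : ℕ → X) :
    Submodule ℝ (ℕ → ℝ) where
  carrier := {a | ∃ s : X, Tendsto (fun N => ∑ n ∈ Finset.range N, a n • x n) atTop (𝓝 s)}
  zero_mem' := ⟨0, by simp⟩
  add_mem' := by
    rintro a b ⟨s, hs⟩ ⟨t, ht⟩
    exact ⟨s + t, by simpa [add_smul, Finset.sum_add_distrib] using hs.add ht⟩
  smul_mem' := by
    rintro c a ⟨s, hs⟩
    exact ⟨c • s, by simpa [mul_smul, Finset.smul_sum] using hs.const_smul c⟩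

/-- For a normed space `X`, the element of `C₀(ℕ, X)`, the space of sequences of `X` whose norms
tend to `0` with the sup norm, with `k`-th term `v` and all other terms `0`. -/
noncomputable def c0Single {X : Type*} [NormedAddCommGroup X] (k : ℕ) (v : X) : C₀(ℕ, X) where
  toFun := Pi.single k v
  continuous_toFun := continuous_of_discreteTopology
  zero_at_infty' := by
    rw [cocompact_eq_cofinite]
    refine tendsto_const_nhds.congr' ?_
    filter_upwards [(Set.finite_singleton k).compl_mem_cofinite] with n hn
    exact (Pi.single_eq_of_ne (M := fun _ : ℕ => X) hn v).symm

/-- The unit vector basis `(e_k)` of the Banach space `c₀ = C₀(ℕ, ℝ)`. -/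
noncomputable def unitC0 (k : ℕ) : C₀(ℕ, ℝ) := c0Single k 1

/-- `e^i_k`: the `k`-th unit vector of the `i`-th summand (`i = 0, …, m - 1`) of the direct sum
`c₀ ⊕ ⋯ ⊕ c₀` of `m` copies of `c₀`. -/
noncomputable def unitFin (m i k : ℕ) : Fin m → C₀(ℕ, ℝ) :=
  fun i' => if (i' : ℕ) = i then unitC0 k else 0

/-- The basis `(x^m_n)` of `c₀ ⊕ ⋯ ⊕ c₀` (`m` copies; this space is isomorphic to `c₀`):
`x^m_n = ∑_{k ≤ j} e^i_k` for `n = m j + i`, `0 ≤ i < m`. -/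
noncomputable def basisFin (m n : ℕ) : Fin m → C₀(ℕ, ℝ) :=
  ∑ k ∈ Finset.range (n / m + 1), unitFin m (n % m) k

/-- `cs^(m)`, for `m ≥ 1`. -/
noncomputable def csFin (m : ℕ) : Submodule ℝ (ℕ → ℝ) := coef (basisFin m)

/-- `e^i_k`: the `k`-th unit vector of the `i`-th summand of the `c₀`-sum
`C₀(ℕ, C₀(ℕ, ℝ))` of countably many copies of `c₀`. -/
noncomputable def unitInf (i k : ℕ) : C₀(ℕ, C₀(ℕ, ℝ)) := c0Single i (unitC0 k)

/-- The basis `(x^∞_n)` of the `c₀`-sum of countably many copies of `c₀` (this space is isomorphic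
to `c₀`), for an enumeration `p` of `ℕ × ℕ`: `x^∞_n = ∑_{k ≤ j} e^i_k` for `n = p (i, j)`. -/
noncomputable def basisInf (p : ℕ × ℕ ≃ ℕ) (n : ℕ) : C₀(ℕ, C₀(ℕ, ℝ)) :=
  ∑ k ∈ Finset.range ((p.symm n).2 + 1), unitInf (p.symm n).1 k

/-- `cs^(∞)`, for the enumeration `p` of `ℕ × ℕ`. -/
noncomputable def csInf (p : ℕ × ℕ ≃ ℕ) : Submodule ℝ (ℕ → ℝ) := coef (basisInf p)

/-! ### Blocks of a strictly increasing sequence -/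

/-! Convergence in the two bases depends only on row series: `a` lies in cs^(m) iff `∑ a n • rowVec
m n` converges in `ℝ^m`, and for cs^(∞) the same holds with the unit vectors of `c₀` in place of
`rowVec`. Inserting zero rows gives linear reductions of cs^(m) to cs^(m+1) and to cs^(∞), and `a ↦
(a 0, -a 0, a 1, -a 1, …)` turns convergence to 0 into convergence of one series. Strictness
follows, by composing reductions, from two facts: cs^(m+1) does not reduce to cs^(m), and cs^(1)
does not reduce to `c₀`.

For these, suppose that `θ` is a Borel reduction, and restrict it to the 0-1 choices of the weighted
unit vectors `weightVec m i`, among which every `2^(-q) e_r` occurs infinitely often. By Baire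
category (`exists_block_decomposition`) there is a copy of the Cantor space on which the partial
sums produced by `θ` split into blocks, the `i`-th of which depends only on the `i`-th bit up to a
summable error. This linearizes the reduction (`SignedReduction`): for signs `σ i` in `{0, 1, -1}`,
`∑ σ i • f i` converges in `ℝ^(m+1)` iff `∑ σ i • v i` converges in `ℝ^m` and `σ i * w i → 0`, where
`v i` is the increment over block `i` and `w i` the oscillation inside it. For the target `c₀` only
the condition on `w` remains, which is the case `m = 0`.

A dimension count excludes this (`not_signedReduction`). Taking up to `N` vectors of length `δ` in
each of `m + 1` rows gives `(N + 1)^(m+1)` sums, whose `v`-counterparts lie in a cube of side `2ε`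
in `ℝ^m`. For suitable `N` and `δ`, two of them are within `4εδ` of each other although the `f`-sums
differ by at least `δ` in some row. Repeating this `1/δ` times on disjoint index sets moves the
`f`-sum by 1 while the partial `v`-sums stay below `6ε`. Concatenating such blocks with `ε → 0`
makes the `v`-series converge and the `f`-series diverge. -/

theorem StrictMono.exists_block {κ : ℕ → ℕ} (hκ : StrictMono κ) (h0 : κ 0 = 0) (l : ℕ) :
    ∃ s, κ s ≤ l ∧ l < κ (s + 1) := by
  have hex : ∃ s, l < κ (s + 1) := ⟨l, lt_of_lt_of_le (Nat.lt_succ_self l) (hκ.id_le (l + 1))⟩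
  classical
  refine ⟨Nat.find hex, ?_, Nat.find_spec hex⟩
  rcases Nat.eq_zero_or_pos (Nat.find hex) with h | h
  · rw [h, h0]; exact Nat.zero_le l
  · have := Nat.find_min hex (Nat.sub_lt h one_pos)
    rw [show Nat.find hex - 1 + 1 = Nat.find hex from Nat.sub_add_cancel h] at this
    exact not_lt.mp this

theorem StrictMono.block_unique {κ : ℕ → ℕ} (hκ : StrictMono κ) {l s t : ℕ}
    (hs : κ s ≤ l ∧ l < κ (s + 1)) (ht : κ t ≤ l ∧ l < κ (t + 1)) : s = t := by
  have h1 := hκ.lt_iff_lt.mp (lt_of_le_of_lt hs.1 ht.2)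
  have h2 := hκ.lt_iff_lt.mp (lt_of_le_of_lt ht.1 hs.2)
  omega

/-! ### Generic continuity on the Cantor space -/

/-- A measurable map into a second countable space is continuous on a residual set. -/
theorem exists_residual_continuousOn {X V : Type*} [TopologicalSpace X] [MeasurableSpace X]
    [BorelSpace X] [TopologicalSpace V] [SecondCountableTopology V] [MeasurableSpace V]
    [OpensMeasurableSpace V] {f : X → V} (hf : Measurable f) :
    ∃ C ∈ residual X, ContinuousOn f C := by
  obtain ⟨B, hBc, -, hB⟩ := TopologicalSpace.exists_countable_basis V
  have hO : ∀ U ∈ B, ∃ O, IsOpen O ∧ f ⁻¹' U =ᶠ[residual X] O := fun U hU =>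
    (hf (hB.isOpen hU).measurableSet).residualEq_isOpen
  choose! O hO hUO using hO
  -- At the points of this set the preimage of each basic open set agrees with its open
  -- representative modulo meager sets.
  refine ⟨{x | ∀ U ∈ B, (f ⁻¹' U) x = (O U) x}, ?_, ?_⟩
  · exact (eventually_countable_ball hBc).mpr fun U hU => hUO U hU
  · intro x hx
    rw [ContinuousWithinAt, hB.nhds_hasBasis.tendsto_right_iff]
    rintro U ⟨hU, hxU⟩
    have hxO : O U x := by rw [← hx U hU]; exact hxU
    filter_upwards [mem_nhdsWithin_of_mem_nhds ((hO U hU).mem_nhds hxO), self_mem_nhdsWithin]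
      with y hyO hy
    have : (f ⁻¹' U) y := by rw [hy U hU]; exact hyO
    exact this

/-- The homeomorphism of the Cantor space that flips the coordinates in `g`. -/
def cantorFlip (g : Finset ℕ) : (ℕ → Bool) ≃ₜ (ℕ → Bool) where
  toFun x n := if n ∈ g then !x n else x n
  invFun x n := if n ∈ g then !x n else x n
  left_inv x := by ext n; by_cases h : n ∈ g <;> simp [h]
  right_inv x := by ext n; by_cases h : n ∈ g <;> simp [h]
  continuous_toFun := by
    refine continuous_pi fun n => ?_
    by_cases h : n ∈ g
    · simpa [h, Function.comp_def] using
        (continuous_of_discreteTopology (f := Bool.not)).comp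
          (continuous_apply (A := fun _ : ℕ => Bool) n)
    · simpa [h] using continuous_apply n
  continuous_invFun := by
    refine continuous_pi fun n => ?_
    by_cases h : n ∈ g
    · simpa [h, Function.comp_def] using
        (continuous_of_discreteTopology (f := Bool.not)).comp
          (continuous_apply (A := fun _ : ℕ => Bool) n)
    · simpa [h] using continuous_apply n

theorem cantorFlip_apply (g : Finset ℕ) (x : ℕ → Bool) (n : ℕ) :
    cantorFlip g x n = if n ∈ g then !x n else x n := rfl

theorem exists_cantorFlip_eq {m : ℕ} {x y : ℕ → Bool} (h : ∀ l ≥ m, x l = y l) :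
    ∃ g ∈ (Finset.range m).powerset, cantorFlip g x = y := by
  refine ⟨(Finset.range m).filter fun l => x l ≠ y l,
    Finset.mem_powerset.mpr (Finset.filter_subset _ _), ?_⟩
  ext n
  rw [cantorFlip_apply]
  by_cases hn : x n = y n
  · simp [hn]
  · have hm : n < m := by
      by_contra hm
      exact hn (h n (not_lt.mp hm))
    have : n ∈ (Finset.range m).filter fun l => x l ≠ y l := by simp [hm, hn]
    rw [if_pos this]
    cases hx : x n <;> cases hy : y n <;> simp_all

theorem cantorFlip_apply_of_ge {m n : ℕ} {g : Finset ℕ} (hg : g ∈ (Finset.range m).powerset)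
    (hn : m ≤ n) (x : ℕ → Bool) : cantorFlip g x n = x n := by
  rw [cantorFlip_apply, if_neg]
  intro h
  have := Finset.mem_range.mp (Finset.mem_powerset.mp hg h)
  omega

/-- Countably many Borel maps on the Cantor space are continuous on a common dense `Gδ` set that
is invariant under finite modifications. -/
theorem exists_dense_iInter_continuousOn {V : Type*} [TopologicalSpace V]
    [SecondCountableTopology V] [MeasurableSpace V] [OpensMeasurableSpace V]
    {S : (ℕ → Bool) → ℕ → V} (hS : ∀ k, Measurable fun x => S x k) :
    ∃ W : ℕ → Set (ℕ → Bool), (∀ n, IsOpen (W n)) ∧ Dense (⋂ n, W n) ∧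
      (∀ g, ∀ x ∈ ⋂ n, W n, cantorFlip g x ∈ ⋂ n, W n) ∧
      ∀ k, ContinuousOn (fun x => S x k) (⋂ n, W n) := by
  choose C hC hcont using fun k => exists_residual_continuousOn (hS k)
  obtain ⟨G, hGsub, hGδ, hGd⟩ := mem_residual.mp (countable_iInter_mem.mpr hC)
  -- Intersecting over the countable group of flips, which are homeomorphisms, keeps a dense Gδ set
  -- and makes it invariant.
  let D : Set (ℕ → Bool) := ⋂ g : Finset ℕ, cantorFlip g ⁻¹' G
  have hDδ : IsGδ D := IsGδ.iInter fun g => hGδ.preimage (cantorFlip g).continuous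
  have hDd : Dense D := by
    refine dense_of_mem_residual (countable_iInter_mem.mpr fun g => ?_)
    have := residual_of_dense_Gδ hGδ hGd
    rw [← (cantorFlip g).residual_map_eq] at this
    exact this
  obtain ⟨W, hW, hDW⟩ := isGδ_iff_eq_iInter_nat.mp hDδ
  refine ⟨W, hW, hDW ▸ hDd, ?_, fun k => ?_⟩
  · rw [← hDW]
    intro g x hx
    refine Set.mem_iInter.mpr fun g' => ?_
    have h := Set.mem_iInter.mp hx (symmDiff g g')
    have e : cantorFlip g' (cantorFlip g x) = cantorFlip (symmDiff g g') x := by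
      ext n
      simp only [cantorFlip_apply, Finset.mem_symmDiff]
      by_cases h1 : n ∈ g <;> by_cases h2 : n ∈ g' <;> simp [h1, h2]
    rw [Set.mem_preimage, e]
    exact h
  · rw [← hDW]
    refine (hcont k).mono fun x hx => ?_
    have h := Set.mem_iInter.mp hx ∅
    have e : cantorFlip ∅ x = x := by ext n; simp [cantorFlip_apply]
    rw [Set.mem_preimage, e] at h
    exact Set.mem_iInter.mp (hGsub h) k

theorem exists_cylinder_of_eventually {P : (ℕ → Bool) → Prop} {c : ℕ → Bool}
    (h : ∀ᶠ x in 𝓝 c, P x) : ∃ n, ∀ x, (∀ l < n, x l = c l) → P x := by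
  obtain ⟨O, hO, hOo, hc⟩ := eventually_nhds_iff.mp h
  obtain ⟨-, ⟨y, n, rfl⟩, hcy, hsub⟩ :=
    (PiNat.isTopologicalBasis_cylinders fun _ : ℕ => Bool).exists_subset_of_mem_open hc hOo
  refine ⟨n, fun x hx => hO x (hsub ?_)⟩
  rw [PiNat.mem_cylinder_iff] at hcy ⊢
  intro i hi
  rw [hx i hi, hcy i hi]

/-- Only finitely many flips act below `m`, and each changes `S x` by a Cauchy sequence, so by Baire
category one index `N₁` serves for all of them on some open set. Continuity at a point `c` of `C` in
that set controls the finitely many `S x k` with `k ≤ N`. Flips below `m` carry both estimates from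
points near `c` to points that merely share the segment of `c` on `[m, n)`. -/
theorem exists_stabilizing_segment {V : Type*} [NormedAddCommGroup V]
    {S : (ℕ → Bool) → ℕ → V} {C : Set (ℕ → Bool)} (hCδ : IsGδ C) (hCd : Dense C)
    (hflip : ∀ g, ∀ x ∈ C, cantorFlip g x ∈ C)
    (hcont : ∀ k, ContinuousOn (fun x => S x k) C)
    (hfin : ∀ x y, (∀ᶠ n in atTop, x n = y n) → CauchySeq fun k => S x k - S y k)
    {W : Set (ℕ → Bool)} (hW : IsOpen W) (hCW : C ⊆ W) (m N₀ : ℕ) {ε : ℝ} (hε : 0 < ε) :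
    ∃ (n N : ℕ) (t : ℕ → Bool), m < n ∧ N₀ < N ∧
      (∀ x, (∀ l, m ≤ l → l < n → x l = t l) → x ∈ W) ∧
      (∀ x ∈ C, ∀ y ∈ C, (∀ l, m ≤ l → l < n → x l = t l) → (∀ l ≥ m, x l = y l) →
        ∀ k ≥ N, ∀ k' ≥ N, ‖(S x k - S y k) - (S x k' - S y k')‖ ≤ ε) ∧
      (∀ x ∈ C, ∀ y ∈ C, (∀ l, m ≤ l → l < n → x l = t l) → (∀ l, m ≤ l → l < n → y l = t l) →
        (∀ l < m, x l = y l) → ∀ k ≤ N, ‖S x k - S y k‖ ≤ ε) := by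
  have hcf : ∀ g k, ContinuousOn (fun x => S (cantorFlip g x) k) C := fun g k =>
    (hcont k).comp (cantorFlip g).continuous.continuousOn fun x hx => hflip g x hx
  let F : ℕ → Set (ℕ → Bool) := fun N => {x | x ∈ C ∧ ∀ g ∈ (Finset.range m).powerset,
    ∀ k ≥ N, ∀ k' ≥ N, ‖(S (cantorFlip g x) k - S x k) - (S (cantorFlip g x) k' - S x k')‖ ≤ ε / 2}
  have hCF : C ⊆ ⋃ N, closure (F N) := by
    intro x hx
    have h : ∀ᶠ N : ℕ in atTop, ∀ g ∈ (Finset.range m).powerset, ∀ k ≥ N, ∀ k' ≥ N,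
        ‖(S (cantorFlip g x) k - S x k) - (S (cantorFlip g x) k' - S x k')‖ ≤ ε / 2 := by
      rw [eventually_all_finset]
      intro g hg
      have hc := hfin (cantorFlip g x) x (by
        filter_upwards [eventually_ge_atTop m] with n hn
        exact cantorFlip_apply_of_ge hg hn x)
      obtain ⟨N, hN⟩ := Metric.cauchySeq_iff.mp hc (ε / 2) (half_pos hε)
      filter_upwards [eventually_ge_atTop N] with M hM k hk k' hk'
      have := hN k (hM.trans hk) k' (hM.trans hk')
      rw [dist_eq_norm] at this
      exact this.le
    obtain ⟨N, hN⟩ := h.exists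
    exact Set.mem_iUnion.mpr ⟨N, subset_closure ⟨hx, hN⟩⟩
  obtain ⟨c₀, hc₀⟩ := (hCδ.dense_iUnion_interior_of_closed hCd (fun N => isClosed_closure)
    hCF).nonempty
  obtain ⟨N₁, hN₁⟩ := Set.mem_iUnion.mp hc₀
  obtain ⟨c, hcI, hcC⟩ := hCd.inter_open_nonempty _ isOpen_interior ⟨c₀, hN₁⟩
  -- The inequality defining `F N₁` is closed relative to `C`, so within `C` it passes to the
  -- closure.
  have hF : ∀ x ∈ C, x ∈ interior (closure (F N₁)) → x ∈ F N₁ := by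
    intro x hx hxI
    refine ⟨hx, fun g hg k hk k' hk' => ?_⟩
    have hφ : ContinuousOn (fun x => ‖(S (cantorFlip g x) k - S x k) -
        (S (cantorFlip g x) k' - S x k')‖) C :=
      (((hcf g k).sub (hcont k)).sub ((hcf g k').sub (hcont k'))).norm
    exact ContinuousWithinAt.closure_le (interior_subset hxI)
      ((hφ x hx).mono fun y hy => hy.1) continuousWithinAt_const
      fun y hy => hy.2 g hg k hk k' hk'
  set N := max N₁ (N₀ + 1) with hN
  have E1 : ∀ᶠ x in 𝓝 c, ∀ g ∈ (Finset.range m).powerset, cantorFlip g x ∈ W := by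
    rw [eventually_all_finset]
    intro g _
    exact (cantorFlip g).continuous.continuousAt.eventually_mem
      (hW.mem_nhds (hCW (hflip g c hcC)))
  have E2 : ∀ᶠ x in 𝓝 c, x ∈ interior (closure (F N₁)) := isOpen_interior.mem_nhds hcI
  have E3 : ∀ᶠ x in 𝓝 c, x ∈ C → ∀ g ∈ (Finset.range m).powerset, ∀ k ∈ Finset.range (N + 1),
      ‖S (cantorFlip g x) k - S (cantorFlip g c) k‖ ≤ ε / 2 := by
    rw [← eventually_nhdsWithin_iff, eventually_all_finset]
    intro g _
    rw [eventually_all_finset]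
    intro k _
    have := Metric.continuousWithinAt_iff'.mp (hcf g k c hcC) (ε / 2) (half_pos hε)
    filter_upwards [this] with x hx
    rw [dist_eq_norm] at hx
    exact hx.le
  obtain ⟨n₁, hn₁⟩ := exists_cylinder_of_eventually (E1.and (E2.and E3))
  have key : ∀ x : ℕ → Bool, (∀ l, m ≤ l → l < max n₁ (m + 1) → x l = c l) →
      ∃ x' : ℕ → Bool, (∀ l < n₁, x' l = c l) ∧ (∀ l ≥ m, x' l = x l) ∧ (∀ l < m, x' l = c l) := by
    intro x hx
    refine ⟨fun l => if l < m then c l else x l, fun l hl => ?_, fun l hl => ?_, fun l hl => ?_⟩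
    · by_cases h : l < m
      · simp [h]
      · simp only [h, if_false]
        exact hx l (not_lt.mp h) (lt_max_of_lt_left hl)
    · simp [not_lt.mpr hl]
    · simp [hl]
  refine ⟨max n₁ (m + 1), N, c, by omega, by omega, fun x hx => ?_, ?_, ?_⟩
  · obtain ⟨x', h1, h2, -⟩ := key x hx
    obtain ⟨g, hg, rfl⟩ := exists_cantorFlip_eq h2
    exact (hn₁ x' h1).1 g hg
  · intro x hx y hy hxc hxy k hk k' hk'
    obtain ⟨x', h1, h2, -⟩ := key x hxc
    obtain ⟨g, hg, hgx⟩ := exists_cantorFlip_eq h2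
    obtain ⟨g', hg', hgy⟩ := exists_cantorFlip_eq (fun l hl => (h2 l hl).trans (hxy l hl))
    obtain ⟨f, hf, hfx⟩ := exists_cantorFlip_eq (fun l hl => (h2 l hl).symm)
    have hx'C : x' ∈ C := hfx ▸ hflip f x hx
    have hx'F := (hF x' hx'C (hn₁ x' h1).2.1).2
    have a1 := hx'F g hg k (le_of_max_le_left hk) k' (le_of_max_le_left hk')
    have a2 := hx'F g' hg' k (le_of_max_le_left hk) k' (le_of_max_le_left hk')
    rw [hgx] at a1
    rw [hgy] at a2
    calc ‖(S x k - S y k) - (S x k' - S y k')‖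
        = ‖((S x k - S x' k) - (S x k' - S x' k')) - ((S y k - S x' k) - (S y k' - S x' k'))‖ := by
          congr 1; abel
      _ ≤ ε / 2 + ε / 2 := (norm_sub_le _ _).trans (add_le_add a1 a2)
      _ = ε := add_halves ε
  · intro x hx y hy hxc hyc hxy k hk
    obtain ⟨x', h1, h2, h3⟩ := key x hxc
    obtain ⟨y', k1, k2, k3⟩ := key y hyc
    obtain ⟨g, hg, hgx⟩ := exists_cantorFlip_eq h2
    obtain ⟨f, hf, hfx⟩ := exists_cantorFlip_eq (fun l hl => (h2 l hl).symm)
    obtain ⟨f', hf', hfy⟩ := exists_cantorFlip_eq (fun l hl => (k2 l hl).symm)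
    have hx'C : x' ∈ C := hfx ▸ hflip f x hx
    have hy'C : y' ∈ C := hfy ▸ hflip f' y hy
    have hgy : cantorFlip g y' = y := by
      ext l
      rcases lt_or_ge l m with hl | hl
      · have := congrFun hgx l
        rw [cantorFlip_apply, h3 l hl, hxy l hl] at this
        rw [cantorFlip_apply, k3 l hl, this]
      · rw [cantorFlip_apply_of_ge hg hl, k2 l hl]
    have a1 := (hn₁ x' h1).2.2 hx'C g hg k (Finset.mem_range.mpr (Nat.lt_succ_of_le hk))
    have a2 := (hn₁ y' k1).2.2 hy'C g hg k (Finset.mem_range.mpr (Nat.lt_succ_of_le hk))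
    rw [hgx] at a1
    rw [hgy] at a2
    calc ‖S x k - S y k‖
        = ‖(S x k - S (cantorFlip g c) k) - (S y k - S (cantorFlip g c) k)‖ := by congr 1; abel
      _ ≤ ε / 2 + ε / 2 := (norm_sub_le _ _).trans (add_le_add a1 a2)
      _ = ε := add_halves ε

/-- A Borel map from the Cantor space to sequences, for which finite modifications of the argument
change the value by a Cauchy sequence, becomes, after restriction to the points of the form
`Function.extend j x b`, a map whose increments on the `i`-th block depend, up to `ε i`, only on the
`i`-th coordinate. -/
theorem exists_block_decomposition {V : Type*} [NormedAddCommGroup V]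
    [SecondCountableTopology V] [MeasurableSpace V] [OpensMeasurableSpace V]
    {S : (ℕ → Bool) → ℕ → V} (hS : ∀ k, Measurable fun x => S x k)
    (hfin : ∀ x y, (∀ᶠ n in atTop, x n = y n) → CauchySeq fun k => S x k - S y k)
    {pos : ℕ → Set ℕ} (hpos : ∀ i, (pos i).Infinite) {ε : ℕ → ℝ} (hε : ∀ i, 0 < ε i) :
    ∃ (b : ℕ → Bool) (j N : ℕ → ℕ), StrictMono j ∧ (∀ i, j i ∈ pos i) ∧ StrictMono N ∧ N 0 = 0 ∧
      ∀ i x y, x i = y i → ∀ k ∈ Set.Icc (N i) (N (i + 1)), ∀ k' ∈ Set.Icc (N i) (N (i + 1)),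
        ‖(S (Function.extend j x b) k - S (Function.extend j y b) k) -
          (S (Function.extend j x b) k' - S (Function.extend j y b) k')‖ ≤ ε i := by
  obtain ⟨W, hWo, hd, hflip, hcont⟩ := exists_dense_iInter_continuousOn hS
  set C := ⋂ n, W n with hC
  have hCδ : IsGδ C := IsGδ.iInter_of_isOpen hWo
  -- The segment following `j i` serves block `i`, by closeness up to `N (i + 1)`, and block `i +
  -- 1`, by stability from `N (i + 1)` on; hence the minimum. The factor 3 pays for the three errors
  -- added at the end.
  let ε' : ℕ → ℝ := fun i => min (ε i) (ε (i + 1)) / 3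
  have hε' : ∀ i, 0 < ε' i := fun i => div_pos (lt_min (hε i) (hε (i + 1))) three_pos
  choose n' N' t hmn hNN hmemW hearly hlate using fun (i m N₀ : ℕ) =>
    exists_stabilizing_segment hCδ hd hflip hcont hfin (hWo i) (Set.iInter_subset W i) m N₀ (hε' i)
  choose J hJpos hJgt using fun (i a : ℕ) => (hpos i).exists_gt a
  -- The state is `(n i, N i)`. The free coordinate `j i` is taken beyond `n i`, and a stabilizing
  -- segment fills the places from `j i + 1` up to `n (i + 1)`.
  let st : ℕ → ℕ × ℕ := fun i => Nat.rec (0, 0)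
    (fun i s => (n' i (J i s.1 + 1) s.2, N' i (J i s.1 + 1) s.2)) i
  let n : ℕ → ℕ := fun i => (st i).1
  let N : ℕ → ℕ := fun i => (st i).2
  let j : ℕ → ℕ := fun i => J i (n i)
  have hn1 : ∀ i, n (i + 1) = n' i (j i + 1) (N i) := fun i => rfl
  have hN1 : ∀ i, N (i + 1) = N' i (j i + 1) (N i) := fun i => rfl
  have hnj : ∀ i, n i < j i := fun i => hJgt i (n i)
  have hjn : ∀ i, j i + 1 < n (i + 1) := fun i => hmn i (j i + 1) (N i)
  have hnmono : StrictMono n := strictMono_nat_of_lt_succ fun i => by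
    have := hnj i; have := hjn i; omega
  have hNmono : StrictMono N := strictMono_nat_of_lt_succ fun i => hNN i (j i + 1) (N i)
  have hjmono : StrictMono j := strictMono_nat_of_lt_succ fun i => by
    have := hnj (i + 1); have := hjn i; omega
  choose s hs using hnmono.exists_block rfl
  let b : ℕ → Bool := fun l => t (s l) (j (s l) + 1) (N (s l)) l
  have hext_j : ∀ x i, Function.extend j x b (j i) = x i := fun x i =>
    hjmono.injective.extend_apply x b i
  have hext_not : ∀ x l, (¬ ∃ i, j i = l) → Function.extend j x b l = b l := fun x l hl =>
    Function.extend_apply' x b l hl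
  have hseg : ∀ x i l, j i + 1 ≤ l → l < n (i + 1) →
      Function.extend j x b l = t i (j i + 1) (N i) l := by
    intro x i l h1 h2
    have hsi : s l = i := hnmono.block_unique (hs l) ⟨by have := hnj i; omega, h2⟩
    rw [hext_not]
    · simp only [b, hsi]
    · rintro ⟨i', rfl⟩
      have a1 : i < i' := hjmono.lt_iff_lt.mp h1
      have a2 : n (i + 1) ≤ n i' := hnmono.monotone a1
      have := hnj i'
      omega
  have hextC : ∀ x, Function.extend j x b ∈ C := fun x =>
    Set.mem_iInter.mpr fun i => hmemW i (j i + 1) (N i) _ (hseg x i)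
  have hA : ∀ i x y, (∀ l ≤ i, x l = y l) → ∀ k ≤ N (i + 1),
      ‖S (Function.extend j x b) k - S (Function.extend j y b) k‖ ≤ ε' i := by
    intro i x y hxy
    refine hlate i (j i + 1) (N i) _ (hextC x) _ (hextC y) (hseg x i) (hseg y i) fun l hl => ?_
    by_cases h : ∃ i', j i' = l
    · obtain ⟨i', rfl⟩ := h
      rw [hext_j, hext_j]
      exact hxy i' (hjmono.le_iff_le.mp (Nat.lt_succ_iff.mp hl))
    · rw [hext_not x l h, hext_not y l h]
  have hB : ∀ i x y, (∀ l, i < l → x l = y l) → ∀ k ≥ N (i + 1), ∀ k' ≥ N (i + 1),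
      ‖(S (Function.extend j x b) k - S (Function.extend j y b) k) -
          (S (Function.extend j x b) k' - S (Function.extend j y b) k')‖ ≤ ε' i := by
    intro i x y hxy
    refine hearly i (j i + 1) (N i) _ (hextC x) _ (hextC y) (hseg x i) fun l hl => ?_
    by_cases h : ∃ i', j i' = l
    · obtain ⟨i', rfl⟩ := h
      rw [hext_j, hext_j]
      exact hxy i' (hjmono.lt_iff_lt.mp hl)
    · rw [hext_not x l h, hext_not y l h]
  refine ⟨b, j, N, hjmono, fun i => hJpos i (n i), hNmono, rfl, ?_⟩
  intro i x y hi k hk k' hk'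
  -- The hybrid `z` is close to `x` for `k ≤ N (i + 1)`, and it differs from `y` only at places
  -- below `i`, an effect that has stabilized from `N i` on.
  let z : ℕ → Bool := fun l => if l ≤ i then x l else y l
  have a1 := hA i x z (fun l hl => by simp [z, hl])
  have a2 : ‖(S (Function.extend j z b) k - S (Function.extend j y b) k) -
          (S (Function.extend j z b) k' - S (Function.extend j y b) k')‖ ≤ ε i / 3 := by
    rcases i with _ | i
    · have : z = y := by
        ext l
        by_cases h : l ≤ 0
        · obtain rfl : l = 0 := by omega
          simp [z, hi]
        · simp only [z, if_neg h]
      rw [this]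
      simpa using (div_pos (hε 0) three_pos).le
    · refine (hB i z y (fun l hl => ?_) k hk.1 k' hk'.1).trans
        (div_le_div_of_nonneg_right (min_le_right _ _) three_pos.le)
      by_cases h : l ≤ i + 1
      · obtain rfl : l = i + 1 := by omega
        simp [z, hi]
      · simp [z, h]
  have a3 : ε' i ≤ ε i / 3 := div_le_div_of_nonneg_right (min_le_left _ _) three_pos.le
  have b1 := (a1 k hk.2).trans a3
  have b2 := (a1 k' hk'.2).trans a3
  set X := S (Function.extend j x b)
  set Y := S (Function.extend j y b)
  set Z := S (Function.extend j z b)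
  calc ‖(X k - Y k) - (X k' - Y k')‖
      = ‖((X k - Z k) - (X k' - Z k')) + ((Z k - Y k) - (Z k' - Y k'))‖ := by congr 1; abel
    _ ≤ (ε i / 3 + ε i / 3) + ε i / 3 :=
        (norm_add_le _ _).trans (add_le_add ((norm_sub_le _ _).trans (add_le_add b1 b2)) a2)
    _ = ε i := by ring

/-! ### Cauchy sequences and blocks -/

theorem cauchySeq_of_blocks {V : Type*} [NormedAddCommGroup V] {D : ℕ → V} {κ : ℕ → ℕ}
    (hκ : StrictMono κ) (h0 : κ 0 = 0) (hc : CauchySeq fun s => D (κ s))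
    (hosc : ∀ ε > 0, ∀ᶠ s in atTop, ∀ k ∈ Set.Icc (κ s) (κ (s + 1)), ‖D k - D (κ s)‖ ≤ ε) :
    CauchySeq D := by
  refine Metric.cauchySeq_iff.mpr fun ε hε => ?_
  obtain ⟨I₁, hI₁⟩ := Metric.cauchySeq_iff.mp hc (ε / 3) (by positivity)
  obtain ⟨I₂, hI₂⟩ := eventually_atTop.mp (hosc (ε / 4) (by positivity))
  have key : ∀ n ≥ κ (max I₁ I₂), ∃ s ≥ I₁, ‖D n - D (κ s)‖ ≤ ε / 4 := by
    intro n hn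
    obtain ⟨s, hs1, hs2⟩ := hκ.exists_block h0 n
    have : max I₁ I₂ < s + 1 := hκ.lt_iff_lt.mp (lt_of_le_of_lt hn hs2)
    exact ⟨s, by omega, hI₂ s (by omega) n ⟨hs1, hs2.le⟩⟩
  refine ⟨κ (max I₁ I₂), fun n hn n' hn' => ?_⟩
  obtain ⟨s, hs, h1⟩ := key n hn
  obtain ⟨s', hs', h2⟩ := key n' hn'
  have h3 := hI₁ s hs s' hs'
  rw [dist_eq_norm] at h3 ⊢
  calc ‖D n - D n'‖ = ‖(D n - D (κ s)) + (D (κ s) - D (κ s')) - (D n' - D (κ s'))‖ := by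
        congr 1; abel
    _ ≤ ‖D n - D (κ s)‖ + ‖D (κ s) - D (κ s')‖ + ‖D n' - D (κ s')‖ :=
        (norm_sub_le _ _).trans (add_le_add_left (norm_add_le _ _) _)
    _ < ε := by linarith

theorem cauchySeq_of_summable_blocks {V : Type*} [NormedAddCommGroup V] {D : ℕ → V} {κ : ℕ → ℕ}
    (hκ : StrictMono κ) (h0 : κ 0 = 0) {η : ℕ → ℝ} (hη : Summable η)
    (hosc : ∀ s, ∀ k ∈ Set.Icc (κ s) (κ (s + 1)), ‖D k - D (κ s)‖ ≤ η s) :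
    CauchySeq D := by
  refine cauchySeq_of_blocks hκ h0 (cauchySeq_of_summable_dist ?_) fun ε hε => ?_
  · refine Summable.of_nonneg_of_le (fun _ => dist_nonneg) (fun s => ?_) hη
    rw [dist_comm, dist_eq_norm]
    exact hosc s _ ⟨(hκ (Nat.lt_succ_self s)).le, le_rfl⟩
  · filter_upwards [hη.tendsto_atTop_zero.eventually_le_const hε] with s hs k hk
    exact (hosc s k hk).trans hs

/-! ### Signed partial sums -/

/-- The values allowed for a choice of signs. -/
def signValues : Set ℝ := {0, 1, -1}

/-- The partial sums of the signed series `∑ σ i • u i`. -/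
def signedSum {V : Type*} [AddCommGroup V] [Module ℝ V] (σ : ℕ → ℝ) (u : ℕ → V) (n : ℕ) : V :=
  ∑ i ∈ Finset.range n, σ i • u i

theorem signedSum_sub {V : Type*} [AddCommGroup V] [Module ℝ V] (σ : ℕ → ℝ) (u : ℕ → V)
    {a b : ℕ} (h : a ≤ b) :
    signedSum σ u b - signedSum σ u a = ∑ i ∈ Finset.Ico a b, σ i • u i :=
  (Finset.sum_Ico_eq_sub _ h).symm

theorem signedSum_eq_zero {V : Type*} [AddCommGroup V] [Module ℝ V] {σ : ℕ → ℝ} (u : ℕ → V)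
    {K k : ℕ} (h : ∀ i, σ i ≠ 0 → K ≤ i) (hk : k ≤ K) : signedSum σ u k = 0 := by
  refine Finset.sum_eq_zero fun i hi => ?_
  have : σ i = 0 := by
    by_contra hne
    have := h i hne
    have := Finset.mem_range.mp hi
    omega
  rw [this, zero_smul]

theorem signedSum_eq_of_ge {V : Type*} [AddCommGroup V] [Module ℝ V] {σ : ℕ → ℝ} (u : ℕ → V)
    {B k : ℕ} (h : ∀ i, σ i ≠ 0 → i < B) (hk : B ≤ k) : signedSum σ u k = signedSum σ u B := by
  refine (Finset.sum_subset (Finset.range_subset_range.mpr hk) fun i _ hi => ?_).symm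
  have : σ i = 0 := by
    by_contra hne
    exact hi (Finset.mem_range.mpr (h i hne))
  rw [this, zero_smul]

theorem signedSum_add {V : Type*} [AddCommGroup V] [Module ℝ V] (σ τ : ℕ → ℝ) (u : ℕ → V) (n : ℕ) :
    signedSum (fun i => σ i + τ i) u n = signedSum σ u n + signedSum τ u n := by
  simp [signedSum, add_smul, Finset.sum_add_distrib]

/-! ### Stitching finitely supported sign sequences together -/

/-- `τ K` is a sign sequence supported on `[K, B K)`. -/
structure IsSignBlock (K B : ℕ) (τ : ℕ → ℝ) : Prop where
  mem : ∀ i, τ i ∈ signValues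
  ge : ∀ i, τ i ≠ 0 → K ≤ i
  lt : ∀ i, τ i ≠ 0 → i < B

theorem IsSignBlock.mono {K K' B B' : ℕ} {τ : ℕ → ℝ} (h : IsSignBlock K B τ) (hK : K' ≤ K)
    (hB : B ≤ B') : IsSignBlock K' B' τ :=
  ⟨h.mem, fun i hi => hK.trans (h.ge i hi), fun i hi => (h.lt i hi).trans_le hB⟩

/-- This combines counterexamples found at every scale into one sequence. Each block starts at or
after the bound `B` of the previous one, and `τ` is indexed by the starting point, so that errors
`(1 / 2) ^ K` become summable. -/
theorem exists_stitching (τ : ℕ → ℕ → ℝ) (B : ℕ → ℕ) :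
    ∃ (κ : ℕ → ℕ) (σ : ℕ → ℝ), StrictMono κ ∧ κ 0 = 0 ∧ (∀ s, B (κ s) ≤ κ (s + 1)) ∧
      ∀ s i, κ s ≤ i → i < κ (s + 1) → σ i = τ (κ s) i := by
  let κ : ℕ → ℕ := fun s => Nat.rec 0 (fun _ k => max (k + 1) (B k)) s
  have hκ1 : ∀ s, κ (s + 1) = max (κ s + 1) (B (κ s)) := fun s => rfl
  have hκ : StrictMono κ := strictMono_nat_of_lt_succ fun s => by rw [hκ1]; omega
  choose b hb using hκ.exists_block rfl
  refine ⟨κ, fun i => τ (κ (b i)) i, hκ, rfl, fun s => by rw [hκ1]; omega, fun s i h1 h2 => ?_⟩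
  change τ (κ (b i)) i = _
  rw [hκ.block_unique (hb i) ⟨h1, h2⟩]

section Stitching

variable {τ : ℕ → ℕ → ℝ} {B κ : ℕ → ℕ} {σ : ℕ → ℝ}

theorem stitching_mem (hτ : ∀ K, IsSignBlock K (B K) (τ K)) (hκ : StrictMono κ) (h0 : κ 0 = 0)
    (hσ : ∀ s i, κ s ≤ i → i < κ (s + 1) → σ i = τ (κ s) i) (i : ℕ) : σ i ∈ signValues := by
  obtain ⟨s, h1, h2⟩ := hκ.exists_block h0 i
  rw [hσ s i h1 h2]
  exact (hτ _).mem i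

theorem stitching_signedSum_sub {V : Type*} [AddCommGroup V] [Module ℝ V] (u : ℕ → V)
    (hτ : ∀ K, IsSignBlock K (B K) (τ K))
    (hσ : ∀ s i, κ s ≤ i → i < κ (s + 1) → σ i = τ (κ s) i) {s k : ℕ}
    (hk : k ∈ Set.Icc (κ s) (κ (s + 1))) :
    signedSum σ u k - signedSum σ u (κ s) = signedSum (τ (κ s)) u k := by
  have : signedSum (τ (κ s)) u k = signedSum (τ (κ s)) u k - signedSum (τ (κ s)) u (κ s) := by
    rw [signedSum_eq_zero u (hτ (κ s)).ge le_rfl, sub_zero]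
  rw [this, signedSum_sub _ _ hk.1, signedSum_sub _ _ hk.1]
  refine Finset.sum_congr rfl fun i hi => ?_
  obtain ⟨h1, h2⟩ := Finset.mem_Ico.mp hi
  rw [hσ s i h1 (h2.trans_le hk.2)]

theorem stitching_cauchySeq {V : Type*} [NormedAddCommGroup V] [Module ℝ V] {u : ℕ → V}
    (hτ : ∀ K, IsSignBlock K (B K) (τ K)) (hκ : StrictMono κ) (h0 : κ 0 = 0)
    (hσ : ∀ s i, κ s ≤ i → i < κ (s + 1) → σ i = τ (κ s) i)
    (hu : ∀ K k, ‖signedSum (τ K) u k‖ ≤ (1 / 2) ^ K) : CauchySeq (signedSum σ u) := by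
  refine cauchySeq_of_summable_blocks hκ h0 summable_geometric_two fun s k hk => ?_
  rw [stitching_signedSum_sub u hτ hσ hk]
  exact (hu _ _).trans (pow_le_pow_of_le_one (by norm_num) (by norm_num) (hκ.id_le s))

theorem stitching_eventually_lt {V : Type*} [NormedAddCommGroup V] [Module ℝ V] {u : ℕ → V}
    (hτ : ∀ K, IsSignBlock K (B K) (τ K)) (hκ : StrictMono κ)
    (hB : ∀ s, B (κ s) ≤ κ (s + 1))
    (hσ : ∀ s i, κ s ≤ i → i < κ (s + 1) → σ i = τ (κ s) i)
    (hc : CauchySeq (signedSum σ u)) {ε : ℝ} (hε : 0 < ε) :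
    ∀ᶠ s in atTop, ‖signedSum (τ (κ s)) u (B (κ s))‖ < ε := by
  obtain ⟨N, hN⟩ := Metric.cauchySeq_iff.mp hc ε hε
  filter_upwards [eventually_ge_atTop N] with s hs
  have h1 : N ≤ κ s := hs.trans (hκ.id_le s)
  have h2 : κ s ≤ κ (s + 1) := (hκ (Nat.lt_succ_self s)).le
  have := hN _ (h1.trans h2) _ h1
  rwa [dist_eq_norm, stitching_signedSum_sub u hτ hσ ⟨h2, le_rfl⟩,
    signedSum_eq_of_ge u (hτ _).lt (hB s)] at this

end Stitching

/-! ### No reduction of signed series in `ℝ^(m+1)` to signed series in `ℝ^m` -/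

/-- For all choices of signs, `∑ σ i • f i` converges if and only if `∑ σ i • v i` converges and
`σ i * w i` tends to `0`. -/
def SignedReduction {E V : Type*} [NormedAddCommGroup E] [NormedSpace ℝ E]
    [NormedAddCommGroup V] [NormedSpace ℝ V] (f : ℕ → E) (v : ℕ → V) (w : ℕ → ℝ) : Prop :=
  ∀ σ : ℕ → ℝ, (∀ i, σ i ∈ signValues) → (CauchySeq (signedSum σ f) ↔
    CauchySeq (signedSum σ v) ∧ Tendsto (fun i => σ i * w i) atTop (𝓝 0))

/-- Finite sets that lie far out and carry little mass of `f` have small `v`-sums. -/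
theorem SignedReduction.exists_small_mass {E V : Type*} [NormedAddCommGroup E] [NormedSpace ℝ E]
    [NormedAddCommGroup V] [NormedSpace ℝ V] {f : ℕ → E} {v : ℕ → V} {w : ℕ → ℝ}
    (H : SignedReduction f v w) {ε : ℝ} (hε : 0 < ε) :
    ∃ K : ℕ, ∀ A : Finset ℕ, (∀ i ∈ A, K ≤ i) → ∑ i ∈ A, ‖f i‖ ≤ (1 / 2) ^ K →
      ‖∑ i ∈ A, v i‖ ≤ ε ∧ ∀ i ∈ A, |w i| ≤ ε := by
  -- Stitching counterexamples for all `K` makes the `f`-series converge absolutely, while every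
  -- block keeps a large `v`-sum or a large `w i`.
  by_contra! hcon
  choose A hAK hAf hA using hcon
  let τ : ℕ → ℕ → ℝ := fun K i => if i ∈ A K then 1 else 0
  let B : ℕ → ℕ := fun K => (A K).sup id + 1
  have hlt : ∀ K, ∀ i ∈ A K, i < B K := fun K i hi =>
    Nat.lt_succ_of_le (Finset.le_sup (f := id) hi)
  have hτne : ∀ K i, τ K i ≠ 0 → i ∈ A K := by
    intro K i h
    by_contra hi
    exact h (if_neg hi)
  have hτ : ∀ K, IsSignBlock K (B K) (τ K) := fun K =>
    ⟨fun i => by by_cases h : i ∈ A K <;> simp [τ, h, signValues],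
      fun i hi => hAK K i (hτne K i hi), fun i hi => hlt K i (hτne K i hi)⟩
  obtain ⟨κ, σ, hκ, h0, hB, hσ⟩ := exists_stitching τ B
  have hfc : CauchySeq (signedSum σ f) := by
    refine stitching_cauchySeq hτ hκ h0 hσ fun K k => ?_
    calc ‖signedSum (τ K) f k‖ ≤ ∑ i ∈ Finset.range k, ‖τ K i • f i‖ := norm_sum_le _ _
      _ = ∑ i ∈ (Finset.range k).filter (· ∈ A K), ‖f i‖ := by
          rw [Finset.sum_filter]
          refine Finset.sum_congr rfl fun i _ => ?_
          by_cases h : i ∈ A K <;> simp [τ, h]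
      _ ≤ ∑ i ∈ A K, ‖f i‖ := Finset.sum_le_sum_of_subset_of_nonneg
          (fun i hi => (Finset.mem_filter.mp hi).2) fun _ _ _ => norm_nonneg _
      _ ≤ _ := hAf K
  obtain ⟨hv, hw⟩ := (H σ (stitching_mem hτ hκ h0 hσ)).mp hfc
  obtain ⟨I, hI⟩ := Metric.tendsto_atTop.mp hw ε hε
  obtain ⟨s, hs, hIs⟩ := ((stitching_eventually_lt hτ hκ hB hσ hv hε).and
    (eventually_ge_atTop I)).exists
  have hsum : signedSum (τ (κ s)) v (B (κ s)) = ∑ i ∈ A (κ s), v i := by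
    unfold signedSum
    rw [← Finset.sum_subset (s₁ := A (κ s)) (fun i hi => Finset.mem_range.mpr (hlt _ i hi))
      (fun i _ hi => by simp [τ, hi])]
    exact Finset.sum_congr rfl fun i hi => by simp [τ, hi]
  rw [hsum] at hs
  obtain ⟨i, hi, hwi⟩ := hA (κ s) hs.le
  have h1 : κ s ≤ i := hAK _ i hi
  have h2 := hI i (hIs.trans ((hκ.id_le s).trans h1))
  rw [hσ s i h1 ((hlt _ i hi).trans_le (hB s))] at h2
  simp only [τ, hi, if_true, one_mul, dist_zero_right, Real.norm_eq_abs] at h2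
  linarith

/-- Pigeonhole principle in the cube `[-ε, ε]^m`. -/
theorem exists_ne_norm_sub_le {T : Type*} [Fintype T] {m P : ℕ} (hP : 2 ≤ P)
    (hcard : P ^ m < Fintype.card T) {ε : ℝ} (hε : 0 < ε) (F : T → Fin m → ℝ)
    (hF : ∀ t, ‖F t‖ ≤ ε) : ∃ t t', t ≠ t' ∧ ‖F t - F t'‖ ≤ 4 * ε / P := by
  have hP' : (2 : ℝ) ≤ P := by exact_mod_cast hP
  -- Coordinates are rescaled to `[0, P - 1]`, so that the floors lie in `Fin P`. Equal floors mean
  -- distance at most `2 * ε / (P - 1)`, which is at most `4 * ε / P` because `P ≥ 2`.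
  let g : T → Fin m → ℝ := fun t c => (F t c + ε) / (2 * ε) * (P - 1)
  have hg0 : ∀ t c, 0 ≤ g t c ∧ g t c ≤ P - 1 := by
    intro t c
    have h := abs_le.mp ((norm_le_pi_norm (F t) c).trans (hF t))
    have h1 : 0 ≤ (F t c + ε) / (2 * ε) := div_nonneg (by linarith) (by positivity)
    have h2 : (F t c + ε) / (2 * ε) ≤ 1 := by
      rw [div_le_one (by positivity)]; linarith
    exact ⟨mul_nonneg h1 (by linarith), mul_le_of_le_one_left (by linarith) h2⟩
  have hfl : ∀ t c, ⌊g t c⌋₊ < P := fun t c => by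
    rw [Nat.floor_lt (hg0 t c).1]
    linarith [(hg0 t c).2]
  obtain ⟨t, t', hne, heq⟩ := Fintype.exists_ne_map_eq_of_card_lt
    (fun t => (fun c => ⟨⌊g t c⌋₊, hfl t c⟩ : Fin m → Fin P)) (by simpa using hcard)
  refine ⟨t, t', hne, (pi_norm_le_iff_of_nonneg (by positivity)).mpr fun c => ?_⟩
  have hc : ⌊g t c⌋₊ = ⌊g t' c⌋₊ := congrArg Fin.val (congrFun heq c)
  have a1 := Nat.floor_le (hg0 t c).1
  have a2 := Nat.lt_floor_add_one (g t c)
  have a3 := Nat.floor_le (hg0 t' c).1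
  have a4 := Nat.lt_floor_add_one (g t' c)
  rw [hc] at a1 a2
  have habs : |g t c - g t' c| ≤ 1 := abs_le.mpr ⟨by linarith, by linarith⟩
  have hdiff : F t c - F t' c = (g t c - g t' c) * (2 * ε / (P - 1)) := by
    have : (P : ℝ) - 1 ≠ 0 := by linarith
    simp only [g]
    field_simp
    ring
  rw [Pi.sub_apply, hdiff, Real.norm_eq_abs, abs_mul,
    abs_of_nonneg (div_nonneg (by positivity) (by linarith) : 0 ≤ 2 * ε / ((P : ℝ) - 1))]
  calc |g t c - g t' c| * (2 * ε / (P - 1)) ≤ 1 * (2 * ε / (P - 1)) :=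
        mul_le_mul_of_nonneg_right habs (div_nonneg (by positivity) (by linarith))
    _ ≤ 4 * ε / P := by
        rw [one_mul, div_le_div_iff₀ (by linarith) (by linarith)]
        nlinarith

theorem signedSum_indicator_sub {V : Type*} [AddCommGroup V] [Module ℝ V] (A A' : Finset ℕ)
    (u : ℕ → V) (k : ℕ) :
    signedSum (fun i => (if i ∈ A then 1 else 0) - if i ∈ A' then 1 else 0) u k =
      ∑ i ∈ A.filter (· < k), u i - ∑ i ∈ A'.filter (· < k), u i := by
  have h : ∀ A : Finset ℕ, ∑ i ∈ Finset.range k, (if i ∈ A then (1 : ℝ) else 0) • u i =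
      ∑ i ∈ A.filter (· < k), u i := by
    intro A
    have : A.filter (· < k) = (Finset.range k).filter (· ∈ A) := by
      ext i; simp [and_comm]
    rw [this, Finset.sum_filter]
    exact Finset.sum_congr rfl fun i _ => by by_cases hi : i ∈ A <;> simp [hi]
  simp only [signedSum, sub_smul, Finset.sum_sub_distrib, h]

/-- Far out there are two sets of vectors `Pi.single r δ` whose `v`-sums almost agree, but
whose `f`-sums differ. -/
theorem exists_signBlock {m : ℕ} {f : ℕ → Fin (m + 1) → ℝ} {v : ℕ → Fin m → ℝ} {w : ℕ → ℝ}
    (hf : ∀ (r : Fin (m + 1)) (q K : ℕ), ∃ i ≥ K, f i = Pi.single r ((1 / 2) ^ q))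
    {K₁ : ℕ} {ε : ℝ} (hε : 0 < ε)
    (hsm : ∀ A : Finset ℕ, (∀ i ∈ A, K₁ ≤ i) → ∑ i ∈ A, ‖f i‖ ≤ (1 / 2) ^ K₁ →
      ‖∑ i ∈ A, v i‖ ≤ ε ∧ ∀ i ∈ A, |w i| ≤ ε)
    {q : ℕ} (hq : q = (K₁ + m + 1) * (m + 1)) {K : ℕ} (hK : K₁ ≤ K) :
    ∃ r τ B, IsSignBlock K B τ ∧ (∀ k, ‖signedSum τ v k‖ ≤ 2 * ε) ∧
      ‖signedSum τ v B‖ ≤ 4 * ε / 2 ^ q ∧ (∀ i, |τ i * w i| ≤ ε) ∧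
      (1 / 2) ^ q ≤ signedSum τ f B r := by
  have hδ : (0 : ℝ) < (1 / 2) ^ q := by positivity
  set δ : ℝ := (1 / 2) ^ q with hδdef
  have hinf : ∀ r : Fin (m + 1), {i | K ≤ i ∧ f i = Pi.single r δ}.Infinite := fun r =>
    Set.infinite_of_forall_exists_gt fun a => by
      obtain ⟨i, hi, hfi⟩ := hf r q (max K (a + 1))
      exact ⟨i, ⟨by omega, hfi⟩, by omega⟩
  let Λ : Fin (m + 1) × ℕ → ℕ := fun p => (hinf p.1).natEmbedding _ p.2
  have hΛK : ∀ p, K ≤ Λ p := fun p => ((hinf p.1).natEmbedding _ p.2).2.1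
  have hΛf : ∀ p, f (Λ p) = Pi.single p.1 δ := fun p => ((hinf p.1).natEmbedding _ p.2).2.2
  have hΛinj : Function.Injective Λ := by
    rintro ⟨r, l⟩ ⟨r', l'⟩ h
    have h1 := hΛf (r, l)
    rw [h, hΛf] at h1
    have hr : r = r' := by
      by_contra hne
      have := congrFun h1 r
      simp [hne] at this
      exact hδ.ne this
    subst hr
    have := (hinf r).natEmbedding _ |>.injective (Subtype.ext h)
    exact Prod.ext rfl this
  -- With `c = 2 ^ (-(K₁ + m + 1))`, this is `N = c ^ (-m)`, and `δ = c ^ (m + 1)`. Then `N δ = c`,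
  -- so `N` vectors from each row have total mass `(m + 1) c ≤ (1 / 2) ^ K₁`, while `N ^ (m + 1) = δ
  -- ^ (-m)` is exactly the number of boxes in the pigeonhole argument.
  let N : ℕ := 2 ^ ((K₁ + m + 1) * m)
  let I : (Fin (m + 1) → Fin (N + 1)) → Finset (Fin (m + 1) × ℕ) := fun t =>
    (Finset.univ ×ˢ Finset.range N).filter fun p => p.2 < (t p.1 : ℕ)
  let A : (Fin (m + 1) → Fin (N + 1)) → Finset ℕ := fun t => (I t).image Λ
  have hAK : ∀ t, ∀ i ∈ A t, K ≤ i := by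
    intro t i hi
    obtain ⟨p, -, rfl⟩ := Finset.mem_image.mp hi
    exact hΛK p
  have hnorm : ∀ p, ‖f (Λ p)‖ = δ := by
    intro p
    rw [hΛf, Pi.norm_single, Real.norm_eq_abs, abs_of_pos hδ]
  have hN : ((m + 1 : ℕ) : ℝ) * N * δ ≤ (1 / 2) ^ K₁ := by
    have h1 : m + 1 ≤ 2 ^ (m + 1) := Nat.lt_two_pow_self.le
    have h2 : (m + 1) * N * 2 ^ K₁ ≤ 2 ^ q := by
      calc (m + 1) * N * 2 ^ K₁ ≤ 2 ^ (m + 1) * N * 2 ^ K₁ := by gcongr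
        _ = 2 ^ q := by rw [hq, ← pow_add, ← pow_add]; congr 1; ring
    have h3 : ((m + 1 : ℕ) : ℝ) * N * 2 ^ K₁ ≤ 2 ^ q := by exact_mod_cast h2
    rw [hδdef, one_div, inv_pow, inv_pow, ← div_eq_mul_inv, div_le_iff₀ (by positivity),
      inv_mul_eq_div, le_div_iff₀ (by positivity)]
    exact h3
  have hmass : ∀ t, ∑ i ∈ A t, ‖f i‖ ≤ (1 / 2) ^ K₁ := by
    intro t
    rw [Finset.sum_image hΛinj.injOn]
    simp only [hnorm, Finset.sum_const, nsmul_eq_mul]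
    refine le_trans (mul_le_mul_of_nonneg_right ?_ hδ.le) hN
    have : (I t).card ≤ (m + 1) * N := by
      refine (Finset.card_filter_le _ _).trans ?_
      simp
    exact_mod_cast this
  have hsub : ∀ t, ∀ A' ⊆ A t, ‖∑ i ∈ A', v i‖ ≤ ε ∧ ∀ i ∈ A', |w i| ≤ ε := fun t A' h =>
    hsm A' (fun i hi => hK.trans (hAK t i (h hi)))
      ((Finset.sum_le_sum_of_subset_of_nonneg h fun _ _ _ => norm_nonneg _).trans (hmass t))
  have hrow : ∀ t r, (∑ i ∈ A t, f i) r = (t r : ℕ) * δ := by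
    intro t r
    rw [Finset.sum_image hΛinj.injOn, Finset.sum_apply]
    simp only [hΛf, I]
    rw [Finset.sum_filter, Finset.sum_product, Finset.sum_eq_single r]
    · simp only [Pi.single_eq_same]
      rw [← Finset.sum_filter, Finset.sum_const, nsmul_eq_mul]
      congr 2
      have : (Finset.range N).filter (fun l => l < (t r : ℕ)) = Finset.range (t r : ℕ) := by
        ext l
        simp only [Finset.mem_filter, Finset.mem_range]
        have := (t r).2
        omega
      rw [this, Finset.card_range]
    · intro r' _ hr'
      refine Finset.sum_eq_zero fun l _ => ?_
      simp [Pi.single_eq_of_ne hr'.symm]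
    · simp
  have hcard : (2 ^ q) ^ m < Fintype.card (Fin (m + 1) → Fin (N + 1)) := by
    have : (2 ^ q) ^ m = N ^ (m + 1) := by
      rw [← pow_mul, ← pow_mul, hq]; congr 1; ring
    rw [this]
    simpa using Nat.pow_lt_pow_left (Nat.lt_succ_self N) (Nat.succ_ne_zero m)
  have hq1 : 2 ≤ 2 ^ q := by
    have : 1 ≤ q := by rw [hq]; exact Nat.mul_pos (by omega) (by omega)
    calc 2 = 2 ^ 1 := rfl
      _ ≤ 2 ^ q := Nat.pow_le_pow_right (by norm_num) this
  obtain ⟨t, t', hne, hclose⟩ := exists_ne_norm_sub_le hq1 hcard hε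
    (fun t => ∑ i ∈ A t, v i) fun t => (hsub t _ subset_rfl).1
  obtain ⟨r, hr⟩ := Function.ne_iff.mp hne
  wlog hlt : t' r < t r generalizing t t'
  · exact this t' t hne.symm (by rw [norm_sub_rev]; exact hclose) hr.symm
      (lt_of_le_of_ne (not_lt.mp hlt) hr)
  let B : ℕ := (A t ∪ A t').sup id + 1
  have hB : ∀ i ∈ A t ∪ A t', i < B := fun i hi => Nat.lt_succ_of_le (Finset.le_sup (f := id) hi)
  have hBt : (A t).filter (· < B) = A t :=
    Finset.filter_true_of_mem fun i hi => hB i (Finset.mem_union_left _ hi)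
  have hBt' : (A t').filter (· < B) = A t' :=
    Finset.filter_true_of_mem fun i hi => hB i (Finset.mem_union_right _ hi)
  have hmem : ∀ i, ((if i ∈ A t then 1 else 0) - if i ∈ A t' then 1 else 0 : ℝ) ≠ 0 →
      i ∈ A t ∪ A t' := by
    intro i
    contrapose!
    intro h
    rw [Finset.mem_union, not_or] at h
    simp [h.1, h.2]
  refine ⟨r, fun i => (if i ∈ A t then 1 else 0) - if i ∈ A t' then 1 else 0, B,
    ⟨fun i => ?_, fun i hi => ?_, fun i hi => hB i (hmem i hi)⟩, fun k => ?_, ?_, fun i => ?_, ?_⟩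
  · by_cases h1 : i ∈ A t <;> by_cases h2 : i ∈ A t' <;> simp [h1, h2, signValues]
  · rcases Finset.mem_union.mp (hmem i hi) with h | h
    · exact hAK t i h
    · exact hAK t' i h
  · rw [signedSum_indicator_sub]
    have a1 := (hsub t _ (Finset.filter_subset (· < k) _)).1
    have a2 := (hsub t' _ (Finset.filter_subset (· < k) _)).1
    linarith [norm_sub_le (∑ i ∈ (A t).filter (· < k), v i) (∑ i ∈ (A t').filter (· < k), v i)]
  · rw [signedSum_indicator_sub, hBt, hBt']
    exact_mod_cast hclose
  · by_cases h1 : i ∈ A t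
    · have := (hsub t _ subset_rfl).2 i h1
      by_cases h2 : i ∈ A t'
      · simp [h1, h2, hε.le]
      · simpa [h1, h2] using this
    · by_cases h2 : i ∈ A t'
      · have := (hsub t' _ subset_rfl).2 i h2
        simpa [h1, h2] using this
      · simp [h1, h2, hε.le]
  · rw [signedSum_indicator_sub, hBt, hBt', Pi.sub_apply, hrow, hrow, ← sub_mul]
    have : ((t' r : ℕ) : ℝ) + 1 ≤ (t r : ℕ) := by exact_mod_cast hlt
    nlinarith

/-- Concatenate `2 ^ q` blocks that share a row `r`. Each adds at least `(1 / 2) ^ q` to coordinate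
`r` of the `f`-sum and at most `4 * ε / 2 ^ q` to the norm of the `v`-sum. The totals are 1 and `4 *
ε`, and another `2 * ε` covers partial sums inside a block. -/
theorem SignedReduction.exists_signBlock_one_le {m : ℕ} {f : ℕ → Fin (m + 1) → ℝ}
    {v : ℕ → Fin m → ℝ} {w : ℕ → ℝ} (H : SignedReduction f v w)
    (hf : ∀ (r : Fin (m + 1)) (q K : ℕ), ∃ i ≥ K, f i = Pi.single r ((1 / 2) ^ q))
    (K : ℕ) {ε : ℝ} (hε : 0 < ε) :
    ∃ τ B, IsSignBlock K B τ ∧ (∀ k, ‖signedSum τ v k‖ ≤ 6 * ε) ∧ (∀ i, |τ i * w i| ≤ ε) ∧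
      1 ≤ ‖signedSum τ f B‖ := by
  obtain ⟨K₁, hsm⟩ := H.exists_small_mass hε
  obtain ⟨q, hq⟩ : ∃ q, q = (K₁ + m + 1) * (m + 1) := ⟨_, rfl⟩
  -- One row works for all `K`: otherwise each row `r` fails at some `k r`, hence also beyond it,
  -- and a block beyond all the `k r` would have no row left.
  obtain ⟨r, hr⟩ : ∃ r, ∀ K ≥ K₁, ∃ τ B, IsSignBlock K B τ ∧ (∀ k, ‖signedSum τ v k‖ ≤ 2 * ε) ∧
      ‖signedSum τ v B‖ ≤ 4 * ε / 2 ^ q ∧ (∀ i, |τ i * w i| ≤ ε) ∧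
      (1 / 2) ^ q ≤ signedSum τ f B r := by
    by_contra! hcon
    choose k hk hcon using hcon
    obtain ⟨r, τ, B, hτ, h1, h2, h3, h4⟩ := exists_signBlock hf hε hsm hq
      ((hk 0).trans (Finset.le_sup (f := k) (Finset.mem_univ 0)))
    exact absurd h4 (not_le.mpr (hcon r τ B
      (hτ.mono (Finset.le_sup (f := k) (Finset.mem_univ r)) le_rfl) h1 h2 h3))
  have key : ∀ L : ℕ, ∃ τ B, K₁ ≤ B ∧ IsSignBlock K B τ ∧
      (∀ k, ‖signedSum τ v k‖ ≤ L * (4 * ε / 2 ^ q) + 2 * ε) ∧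
      ‖signedSum τ v B‖ ≤ L * (4 * ε / 2 ^ q) ∧ (∀ i, |τ i * w i| ≤ ε) ∧
      L * (1 / 2) ^ q ≤ signedSum τ f B r := by
    intro L
    induction L with
    | zero =>
      refine ⟨0, max K K₁, le_max_right _ _, ⟨fun i => ?_, fun i h => ?_, fun i h => ?_⟩,
        fun k => ?_, ?_, fun i => ?_, ?_⟩
      · simp [signValues]
      · simp at h
      · simp at h
      · simp [signedSum, hε.le]
      · simp [signedSum]
      · simp [hε.le]
      · simp [signedSum]
    | succ L ih =>
      obtain ⟨τ, B, hB, hτ, h1, h2, h3, h4⟩ := ih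
      obtain ⟨τ', B', hτ', k1, k2, k3, k4⟩ := hr (max K B) (hB.trans (le_max_right _ _))
      have hsup : ∀ i, τ' i = 0 ∨ τ i = 0 := by
        intro i
        by_contra! h
        have := hτ'.ge i h.1
        have := hτ.lt i h.2
        omega
      have hc : 0 ≤ 4 * ε / 2 ^ q := by positivity
      have hge : ∀ k ≥ B, signedSum τ v k = signedSum τ v B := fun k hk =>
        signedSum_eq_of_ge v hτ.lt hk
      have hv : ∀ k ≥ B, signedSum (fun i => τ i + τ' i) v k =
          signedSum τ v B + signedSum τ' v k := fun k hk => by rw [signedSum_add, hge k hk]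
      refine ⟨fun i => τ i + τ' i, max B B', hB.trans (le_max_left _ _),
        ⟨fun i => ?_, fun i hi => ?_, fun i hi => ?_⟩, fun k => ?_, ?_, fun i => ?_, ?_⟩
      · rcases hsup i with h | h
        · simpa [h] using hτ.mem i
        · simpa [h] using hτ'.mem i
      · rcases hsup i with h | h
        · exact hτ.ge i (by simpa [h] using hi)
        · exact (le_max_left _ _).trans (hτ'.ge i (by simpa [h] using hi))
      · rcases hsup i with h | h
        · exact (hτ.lt i (by simpa [h] using hi)).trans_le (le_max_left _ _)
        · exact (hτ'.lt i (by simpa [h] using hi)).trans_le (le_max_right _ _)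
      · push_cast
        rcases le_total k B with hk | hk
        · rw [signedSum_add, signedSum_eq_zero v (K := max K B) hτ'.ge (hk.trans (le_max_right _ _)),
            add_zero]
          linarith [h1 k]
        · rw [hv k hk]
          linarith [norm_add_le (signedSum τ v B) (signedSum τ' v k), k1 k]
      · push_cast
        rw [hv _ (le_max_left _ _), signedSum_eq_of_ge v hτ'.lt (le_max_right _ _)]
        linarith [norm_add_le (signedSum τ v B) (signedSum τ' v B')]
      · rcases hsup i with h | h
        · simpa [h] using h3 i
        · simpa [h] using k3 i
      · push_cast
        rw [signedSum_add, signedSum_eq_of_ge f hτ'.lt (le_max_right _ _),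
          signedSum_eq_of_ge f hτ.lt (le_max_left _ _), Pi.add_apply]
        linarith
  obtain ⟨τ, B, -, hτ, h1, -, h3, h4⟩ := key (2 ^ q)
  have hpow : (0 : ℝ) < 2 ^ q := by positivity
  refine ⟨τ, B, hτ, fun k => (h1 k).trans (le_of_eq ?_), h3, ?_⟩
  · push_cast
    field_simp
    ring
  · refine le_trans ?_ (norm_le_pi_norm (signedSum τ f B) r)
    refine le_trans (le_trans (le_of_eq ?_) h4) (Real.le_norm_self _)
    push_cast
    rw [← mul_pow]
    norm_num

/-- Signed series in `ℝ^(m+1)` do not reduce to signed series in `ℝ^m`. -/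
theorem not_signedReduction {m : ℕ} {f : ℕ → Fin (m + 1) → ℝ} {v : ℕ → Fin m → ℝ} {w : ℕ → ℝ}
    (hf : ∀ (r : Fin (m + 1)) (q K : ℕ), ∃ i ≥ K, f i = Pi.single r ((1 / 2) ^ q)) :
    ¬ SignedReduction f v w := by
  intro H
  -- This `ε` turns the bound `6 * ε` into the summable `(1 / 2) ^ K`.
  choose τ B hτ hv hw hf1 using fun K : ℕ => H.exists_signBlock_one_le hf K
    (ε := (1 / 2) ^ K / 6) (by positivity)
  obtain ⟨κ, σ, hκ, h0, hB, hσ⟩ := exists_stitching τ B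
  have hvc : CauchySeq (signedSum σ v) :=
    stitching_cauchySeq hτ hκ h0 hσ fun K k => (hv K k).trans (le_of_eq (by ring))
  have hwc : Tendsto (fun i => σ i * w i) atTop (𝓝 0) := by
    refine Metric.tendsto_atTop.mpr fun ε hε => ?_
    obtain ⟨s, hs⟩ := exists_pow_lt_of_lt_one hε (by norm_num : (1 / 2 : ℝ) < 1)
    refine ⟨κ s, fun i hi => ?_⟩
    obtain ⟨s', h1, h2⟩ := hκ.exists_block h0 i
    have hss : s ≤ s' := Nat.lt_succ_iff.mp (hκ.lt_iff_lt.mp (hi.trans_lt h2))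
    rw [dist_zero_right, Real.norm_eq_abs, hσ s' i h1 h2]
    have hp : (1 / 2 : ℝ) ^ κ s' ≤ (1 / 2) ^ s :=
      pow_le_pow_of_le_one (by norm_num) (by norm_num) (hss.trans (hκ.id_le s'))
    have : (0 : ℝ) < (1 / 2) ^ κ s' := by positivity
    linarith [hw (κ s') i]
  have hfc := (H σ (stitching_mem hτ hκ h0 hσ)).mpr ⟨hvc, hwc⟩
  obtain ⟨s, hs⟩ := (stitching_eventually_lt hτ hκ hB hσ hfc one_pos).exists
  exact absurd (hf1 (κ s)) (not_le.mpr hs)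

/-! ### The coefficient spaces -/

theorem mem_coef_iff {X : Type*} [NormedAddCommGroup X] [NormedSpace ℝ X] [CompleteSpace X]
    {x : ℕ → X} {a : ℕ → ℝ} : a ∈ coef x ↔ CauchySeq (signedSum a x) :=
  ⟨fun ⟨_, hs⟩ => hs.cauchySeq, fun h => cauchySeq_tendsto_of_complete h⟩

theorem cauchySeq_signedSum_iff {X : Type*} [NormedAddCommGroup X] [NormedSpace ℝ X]
    {x : ℕ → X} {a : ℕ → ℝ} : CauchySeq (signedSum a x) ↔
      ∀ ε > 0, ∃ N, ∀ k l, N ≤ k → k ≤ l → ‖∑ i ∈ Finset.Ico k l, a i • x i‖ ≤ ε := by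
  rw [Metric.cauchySeq_iff]
  constructor
  · intro h ε hε
    obtain ⟨N, hN⟩ := h ε hε
    refine ⟨N, fun k l hk hl => ?_⟩
    have := hN l (hk.trans hl) k hk
    rw [dist_eq_norm, signedSum_sub _ _ hl] at this
    exact this.le
  · intro h ε hε
    obtain ⟨N, hN⟩ := h (ε / 2) (half_pos hε)
    refine ⟨N, fun k hk l hl => ?_⟩
    wlog hkl : l ≤ k generalizing k l
    · rw [dist_comm]
      exact this l hl k hk (le_of_not_ge hkl)
    rw [dist_eq_norm, signedSum_sub _ _ hkl]
    exact (hN l k hl hkl).trans_lt (half_lt_self hε)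

/-- A block sum of `x` need only be controlled by the sums of `ρ` over all final pieces `[i, l)` of
the block, since the Cauchy criterion bounds these simultaneously. -/
theorem cauchySeq_signedSum_congr {X W : Type*} [NormedAddCommGroup X] [NormedSpace ℝ X]
    [NormedAddCommGroup W] [NormedSpace ℝ W] {x : ℕ → X} {ρ : ℕ → W} {a : ℕ → ℝ}
    (h₁ : ∀ k l C, k ≤ l → (∀ i, k ≤ i → i ≤ l → ‖∑ n ∈ Finset.Ico i l, a n • ρ n‖ ≤ C) →
      ‖∑ n ∈ Finset.Ico k l, a n • x n‖ ≤ C)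
    (h₂ : ∀ k l, ‖∑ n ∈ Finset.Ico k l, a n • ρ n‖ ≤ ‖∑ n ∈ Finset.Ico k l, a n • x n‖) :
    CauchySeq (signedSum a x) ↔ CauchySeq (signedSum a ρ) := by
  rw [cauchySeq_signedSum_iff, cauchySeq_signedSum_iff]
  constructor
  · intro h ε hε
    obtain ⟨N, hN⟩ := h ε hε
    exact ⟨N, fun k l hk hl => (h₂ k l).trans (hN k l hk hl)⟩
  · intro h ε hε
    obtain ⟨N, hN⟩ := h ε hε
    exact ⟨N, fun k l hk hl => h₁ k l ε hl fun i hi hil => hN i l (hk.trans hi) hil⟩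

theorem sum_Ico_ite_le_eq (g : ℕ → ℝ) {k l : ℕ} (hkl : k ≤ l) (T : ℕ) :
    ∃ i, k ≤ i ∧ i ≤ l ∧
      ∑ n ∈ Finset.Ico k l, (if T ≤ n then g n else 0) = ∑ n ∈ Finset.Ico i l, g n := by
  refine ⟨max k (min T l), le_max_left _ _, max_le hkl (min_le_right _ _), ?_⟩
  rw [← Finset.sum_filter]
  refine Finset.sum_congr ?_ fun _ _ => rfl
  ext n
  simp only [Finset.mem_filter, Finset.mem_Ico]
  omega

theorem zeroAtInfty_norm_le {X : Type*} [NormedAddCommGroup X] {f : C₀(ℕ, X)} {C : ℝ}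
    (hC : 0 ≤ C) : ‖f‖ ≤ C ↔ ∀ k, ‖f k‖ ≤ C := by
  rw [← ZeroAtInftyContinuousMap.norm_toBCF_eq_norm, BoundedContinuousFunction.norm_le hC]
  rfl

theorem zeroAtInfty_norm_coe_le {X : Type*} [NormedAddCommGroup X] (f : C₀(ℕ, X)) (k : ℕ) :
    ‖f k‖ ≤ ‖f‖ := (zeroAtInfty_norm_le (norm_nonneg f)).mp le_rfl k

theorem zeroAtInfty_sum_apply {X : Type*} [NormedAddCommGroup X] {ι : Type*} (s : Finset ι)
    (f : ι → C₀(ℕ, X)) (k : ℕ) : (∑ i ∈ s, f i) k = ∑ i ∈ s, f i k := by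
  classical
  induction s using Finset.induction_on with
  | empty => simp
  | insert i s hi ih => rw [Finset.sum_insert hi, Finset.sum_insert hi,
      ZeroAtInftyContinuousMap.add_apply, ih]

theorem c0Single_apply {X : Type*} [NormedAddCommGroup X] [NormedSpace ℝ X] (k : ℕ) (v : X)
    (l : ℕ) : c0Single k v l = if l = k then v else 0 := by
  change (Pi.single k v : ℕ → X) l = _
  rw [Pi.single_apply]

theorem unitC0_apply (k l : ℕ) : unitC0 k l = if l = k then 1 else 0 := c0Single_apply k 1 l

theorem basisFin_apply (m n : ℕ) (r : Fin m) (k : ℕ) :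
    basisFin m n r k = if (r : ℕ) = n % m then (if k ≤ n / m then 1 else 0) else 0 := by
  rw [basisFin, Finset.sum_apply, zeroAtInfty_sum_apply]
  simp only [unitFin]
  by_cases h : (r : ℕ) = n % m
  · simp only [h, if_true, unitC0_apply, Finset.sum_ite_eq, Finset.mem_range, Nat.lt_succ_iff]
  · simp [h]

theorem basisInf_apply (p : ℕ × ℕ ≃ ℕ) (n r k : ℕ) :
    basisInf p n r k =
      if r = (p.symm n).1 then (if k ≤ (p.symm n).2 then 1 else 0) else 0 := by
  rw [basisInf, zeroAtInfty_sum_apply, zeroAtInfty_sum_apply]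
  simp only [unitInf, c0Single_apply]
  by_cases h : r = (p.symm n).1
  · simp only [h, if_true, unitC0_apply, Finset.sum_ite_eq, Finset.mem_range, Nat.lt_succ_iff]
  · simp [h]

/-- The unit vector of `ℝ^m` that belongs to the row of `n`. -/
def rowVec (m n : ℕ) : Fin m → ℝ := fun r => if (r : ℕ) = n % m then 1 else 0

/-- Coordinate `j` of row `r` of a block sum collects the terms of that row with `m * j ≤ n`, a
final piece of the block; `j = 0` gives the whole row sum. -/
theorem mem_csFin_iff {m : ℕ} (hm : 1 ≤ m) {a : ℕ → ℝ} :
    a ∈ csFin m ↔ CauchySeq (signedSum a (rowVec m)) := by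
  rw [csFin, mem_coef_iff]
  have happ : ∀ k l r j, (∑ n ∈ Finset.Ico k l, a n • basisFin m n) r j =
      ∑ n ∈ Finset.Ico k l, (if m * j ≤ n then a n * rowVec m n r else 0) := by
    intro k l r j
    rw [Finset.sum_apply, zeroAtInfty_sum_apply]
    refine Finset.sum_congr rfl fun n _ => ?_
    rw [Pi.smul_apply, ZeroAtInftyContinuousMap.smul_apply, basisFin_apply, smul_eq_mul, rowVec]
    have h : m * j ≤ n ↔ j ≤ n / m := by rw [Nat.le_div_iff_mul_le hm, mul_comm]
    by_cases h1 : (r : ℕ) = n % m <;> by_cases h2 : j ≤ n / m <;> simp [h, h1, h2]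
  refine cauchySeq_signedSum_congr (fun k l C hkl h => ?_) fun k l => ?_
  · have hC : 0 ≤ C := (norm_nonneg _).trans (h k le_rfl hkl)
    refine (pi_norm_le_iff_of_nonneg hC).mpr fun r => (zeroAtInfty_norm_le hC).mpr fun j => ?_
    rw [happ]
    obtain ⟨i, hi, hil, heq⟩ := sum_Ico_ite_le_eq (fun n => a n * rowVec m n r) hkl (m * j)
    rw [heq]
    have := (norm_le_pi_norm (∑ n ∈ Finset.Ico i l, a n • rowVec m n) r).trans (h i hi hil)
    simpa [Finset.sum_apply] using this
  · refine (pi_norm_le_iff_of_nonneg (norm_nonneg _)).mpr fun r => ?_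
    have h0 := (zeroAtInfty_norm_coe_le ((∑ n ∈ Finset.Ico k l, a n • basisFin m n) r) 0).trans
      (norm_le_pi_norm _ r)
    rw [happ] at h0
    simpa [Finset.sum_apply] using h0

/-- Since `j ↦ p (r, j)` is increasing, the terms of row `r` that reach coordinate `j` are those
with `p (r, j) ≤ n`, again a final piece of the block. -/
theorem mem_csInf_iff {p : ℕ × ℕ ≃ ℕ} (hp : ∀ i : ℕ, StrictMono fun j : ℕ => p (i, j))
    {a : ℕ → ℝ} :
    a ∈ csInf p ↔ CauchySeq (signedSum a fun n => unitC0 (p.symm n).1) := by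
  rw [csInf, mem_coef_iff]
  have happ : ∀ k l r j, (∑ n ∈ Finset.Ico k l, a n • basisInf p n) r j =
      ∑ n ∈ Finset.Ico k l, (if p (r, j) ≤ n then a n * unitC0 (p.symm n).1 r else 0) := by
    intro k l r j
    rw [zeroAtInfty_sum_apply, zeroAtInfty_sum_apply]
    refine Finset.sum_congr rfl fun n _ => ?_
    rw [ZeroAtInftyContinuousMap.smul_apply, ZeroAtInftyContinuousMap.smul_apply, basisInf_apply,
      smul_eq_mul, unitC0_apply]
    by_cases h1 : r = (p.symm n).1
    · have h2 : p (r, j) ≤ n ↔ j ≤ (p.symm n).2 := by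
        have : p (r, (p.symm n).2) = n := by rw [h1]; exact p.apply_symm_apply n
        conv_lhs => rw [← this]
        exact (hp r).le_iff_le
      rw [if_pos h1, if_pos h1]
      by_cases h3 : j ≤ (p.symm n).2
      · rw [if_pos h3, if_pos (h2.mpr h3)]
      · rw [if_neg h3, if_neg (h3 ∘ h2.mp), mul_zero]
    · simp [h1]
  refine cauchySeq_signedSum_congr (W := C₀(ℕ, ℝ)) (fun k l C hkl h => ?_) fun k l => ?_
  · have hC : 0 ≤ C := (norm_nonneg _).trans (h k le_rfl hkl)
    refine (zeroAtInfty_norm_le hC).mpr fun r => (zeroAtInfty_norm_le hC).mpr fun j => ?_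
    rw [happ]
    obtain ⟨i, hi, hil, heq⟩ :=
      sum_Ico_ite_le_eq (fun n => a n * unitC0 (p.symm n).1 r) hkl (p (r, j))
    rw [heq]
    have := (zeroAtInfty_norm_coe_le
      (∑ n ∈ Finset.Ico i l, a n • unitC0 (p.symm n).1) r).trans (h i hi hil)
    simpa [zeroAtInfty_sum_apply] using this
  · refine (zeroAtInfty_norm_le (norm_nonneg (∑ n ∈ Finset.Ico k l, a n • basisInf p n))).mpr
      fun r => ?_
    rw [zeroAtInfty_sum_apply]
    have hcut : ∀ n, p.symm n = (r, (p.symm n).2) → p (r, 0) ≤ n := by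
      intro n hn
      have : p (r, (p.symm n).2) = n := by rw [← hn]; exact p.apply_symm_apply n
      rw [← this]
      exact (hp r).monotone (Nat.zero_le _)
    have h0 := (zeroAtInfty_norm_coe_le ((∑ n ∈ Finset.Ico k l, a n • basisInf p n) r) 0).trans
      (zeroAtInfty_norm_coe_le _ r)
    rw [happ] at h0
    refine le_trans (le_of_eq ?_) h0
    congr 1
    refine Finset.sum_congr rfl fun n _ => ?_
    rw [ZeroAtInftyContinuousMap.smul_apply, smul_eq_mul, unitC0_apply]
    by_cases h1 : r = (p.symm n).1
    · rw [if_pos (hcut n (Prod.ext h1.symm rfl))]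
    · simp [h1]

/-! ### Series supported on a subsequence -/

theorem cauchySeq_sum_comp_iff {V : Type*} [NormedAddCommGroup V] {j : ℕ → ℕ} (hj : StrictMono j)
    {u : ℕ → V} (hu : ∀ n, (¬ ∃ i, j i = n) → u n = 0) :
    CauchySeq (fun n => ∑ i ∈ Finset.range n, u i) ↔
      CauchySeq (fun n => ∑ i ∈ Finset.range n, u (j i)) := by
  have hE : ∀ I, ∑ i ∈ Finset.range I, u (j i) = ∑ n ∈ Finset.range (j I), u n := by
    intro I
    rw [← Finset.sum_image (s := Finset.range I) (g := j) (f := u) hj.injective.injOn]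
    refine Finset.sum_subset (fun n hn => ?_) fun n hn hn' => hu n ?_
    · obtain ⟨i, hi, rfl⟩ := Finset.mem_image.mp hn
      exact Finset.mem_range.mpr (hj (Finset.mem_range.mp hi))
    · rintro ⟨i, rfl⟩
      exact hn' (Finset.mem_image_of_mem j
        (Finset.mem_range.mpr (hj.lt_iff_lt.mp (Finset.mem_range.mp hn))))
  constructor
  · intro h
    simp only [hE]
    exact h.comp_tendsto hj.tendsto_atTop
  · intro h
    have hex : ∀ n, ∃ I, n ≤ j I := fun n => ⟨n, hj.id_le n⟩
    classical
    have hD : ∀ n, ∑ i ∈ Finset.range n, u i =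
        ∑ i ∈ Finset.range (Nat.find (hex n)), u (j i) := by
      intro n
      rw [hE]
      refine Finset.sum_subset (Finset.range_subset_range.mpr (Nat.find_spec (hex n)))
        fun l hl hl' => hu l ?_
      rintro ⟨i, rfl⟩
      have h1 : i < Nat.find (hex n) := hj.lt_iff_lt.mp (Finset.mem_range.mp hl)
      exact Nat.find_min (hex n) h1 (not_lt.mp fun h => hl' (Finset.mem_range.mpr h))
    simp only [hD]
    refine h.comp_tendsto (tendsto_atTop.mpr fun K => ?_)
    filter_upwards [eventually_gt_atTop (j K)] with n hn
    by_contra hlt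
    have := hj (not_le.mp hlt)
    have := Nat.find_spec (hex n)
    omega

theorem cauchySeq_pi_iff {m : ℕ} {u : ℕ → Fin m → ℝ} :
    CauchySeq u ↔ ∀ r, CauchySeq fun n => u n r := by
  constructor
  · intro h r
    obtain ⟨s, hs⟩ := cauchySeq_tendsto_of_complete h
    exact (tendsto_pi_nhds.mp hs r).cauchySeq
  · intro h
    choose s hs using fun r => cauchySeq_tendsto_of_complete (h r)
    exact (tendsto_pi_nhds.mpr hs : Tendsto u atTop (𝓝 s)).cauchySeq

theorem mem_csFin_iff_rows {m : ℕ} (hm : 1 ≤ m) {a : ℕ → ℝ} :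
    a ∈ csFin m ↔ ∀ r < m, CauchySeq fun n => ∑ j ∈ Finset.range n, a (m * j + r) := by
  rw [mem_csFin_iff hm, cauchySeq_pi_iff]
  have key : ∀ r : Fin m, (CauchySeq fun n => signedSum a (rowVec m) n r) ↔
      CauchySeq fun n => ∑ j ∈ Finset.range n, a (m * j + r) := by
    intro r
    have h1 : (fun n => signedSum a (rowVec m) n r) =
        fun n => ∑ i ∈ Finset.range n, if (r : ℕ) = i % m then a i else 0 := by
      funext n
      simp [signedSum, Finset.sum_apply, rowVec]
    rw [h1, cauchySeq_sum_comp_iff (j := fun j => m * j + r)]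
    · have : ∀ j, (r : ℕ) = (m * j + r) % m := fun j => by
        rw [Nat.mul_add_mod, Nat.mod_eq_of_lt r.2]
      simp only [← this, if_true]
    · exact strictMono_nat_of_lt_succ fun j => by nlinarith
    · intro n hn
      rw [if_neg]
      intro h
      exact hn ⟨n / m, by rw [h]; exact Nat.div_add_mod n m⟩
  exact ⟨fun h r hr => (key ⟨r, hr⟩).mp (h ⟨r, hr⟩), fun h r => (key r).mpr (h r r.2)⟩

/-- With finitely many nonzero rows the partial sums lie in the span of finitely many `unitC0 r`,
where coordinatewise convergence suffices. -/
theorem mem_csInf_iff_rows {p : ℕ × ℕ ≃ ℕ} (hp : ∀ i : ℕ, StrictMono fun j : ℕ => p (i, j))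
    {a : ℕ → ℝ} {m : ℕ} (ha : ∀ r ≥ m, ∀ j, a (p (r, j)) = 0) :
    a ∈ csInf p ↔ ∀ r < m, CauchySeq fun n => ∑ j ∈ Finset.range n, a (p (r, j)) := by
  rw [mem_csInf_iff hp]
  have key : ∀ r, (CauchySeq fun n => ∑ i ∈ Finset.range n, if r = (p.symm i).1 then a i else 0) ↔
      CauchySeq fun n => ∑ j ∈ Finset.range n, a (p (r, j)) := by
    intro r
    rw [cauchySeq_sum_comp_iff (hp r)]
    · simp
    · intro n hn
      rw [if_neg]
      intro h
      exact hn ⟨(p.symm n).2, by rw [h]; exact p.apply_symm_apply n⟩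
  constructor
  · intro h r _
    rw [← key]
    obtain ⟨s, hs⟩ := cauchySeq_tendsto_of_complete h
    have h1 : ∀ n, (∑ i ∈ Finset.range n, if r = (p.symm i).1 then a i else 0) =
        signedSum a (fun n => unitC0 (p.symm n).1) n r := fun n => by
      simp [signedSum, zeroAtInfty_sum_apply, unitC0_apply]
    simp only [h1]
    refine Tendsto.cauchySeq (x := s r) ?_
    refine squeeze_zero_norm (fun n => ?_) (tendsto_iff_norm_sub_tendsto_zero.mp hs) |>
      tendsto_sub_nhds_zero_iff.mp
    exact zeroAtInfty_norm_coe_le (signedSum a (fun n => unitC0 (p.symm n).1) n - s) r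
  · intro h
    choose! s hs using fun r hr => cauchySeq_tendsto_of_complete ((key r).mpr (h r hr))
    have h1 : signedSum a (fun n => unitC0 (p.symm n).1) = fun n => ∑ r ∈ Finset.range m,
        (∑ i ∈ Finset.range n, if r = (p.symm i).1 then a i else 0) • unitC0 r := by
      funext n
      have e : ∀ r, (∑ i ∈ Finset.range n, if r = (p.symm i).1 then a i else 0) • unitC0 r =
          ∑ i ∈ Finset.range n, (if r = (p.symm i).1 then a i else 0) • unitC0 r :=
        fun r => Finset.sum_smul (R := ℝ) (M := C₀(ℕ, ℝ))
      simp only [signedSum, e]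
      rw [Finset.sum_comm]
      refine Finset.sum_congr rfl fun i _ => ?_
      by_cases hi : (p.symm i).1 < m
      · rw [Finset.sum_eq_single (p.symm i).1]
        · simp
        · intro r _ hr
          simp [hr]
        · intro h
          exact absurd (Finset.mem_range.mpr hi) h
      · have h0 : a i = 0 := by
          have := ha (p.symm i).1 (not_lt.mp hi) (p.symm i).2
          rwa [Prod.mk.eta, p.apply_symm_apply] at this
        simp [h0]
    rw [h1]
    exact (tendsto_finsetSum _ fun r hr =>
      (hs r (Finset.mem_range.mp hr)).smul_const (unitC0 r)).cauchySeq

/-! ### Comparing a sequence with signed blocks -/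

/-- The maximum of the norms of `g` over a finite set. -/
noncomputable def finsetSupNorm {V : Type*} [NormedAddCommGroup V] (s : Finset ℕ) (g : ℕ → V) : ℝ :=
  (s.sup fun k => ‖g k‖₊ : NNReal)

theorem tendsto_mul_finsetSupNorm_iff {V : Type*} [NormedAddCommGroup V] [NormedSpace ℝ V]
    {σ : ℕ → ℝ} (hσ : ∀ i, σ i ∈ signValues) {s : ℕ → Finset ℕ} {g : ℕ → ℕ → V} :
    Tendsto (fun i => σ i * finsetSupNorm (s i) (g i)) atTop (𝓝 0) ↔
      ∀ ε > 0, ∀ᶠ i in atTop, ∀ k ∈ s i, ‖σ i • g i k‖ ≤ ε := by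
  have h0 : ∀ i, 0 ≤ finsetSupNorm (s i) (g i) := fun i => NNReal.coe_nonneg _
  have hle : ∀ i, ∀ k ∈ s i, ‖g i k‖ ≤ finsetSupNorm (s i) (g i) := fun i k hk =>
    NNReal.coe_le_coe.mpr (Finset.le_sup (f := fun k => ‖g i k‖₊) hk)
  constructor
  · intro h ε hε
    obtain ⟨I, hI⟩ := Metric.tendsto_atTop.mp h ε hε
    filter_upwards [eventually_ge_atTop I] with i hi k hk
    have := hI i hi
    rw [dist_zero_right, norm_mul, Real.norm_of_nonneg (h0 i)] at this
    rw [norm_smul]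
    exact (mul_le_mul_of_nonneg_left (hle i k hk) (norm_nonneg _)).trans this.le
  · intro h
    refine Metric.tendsto_atTop.mpr fun ε hε => ?_
    obtain ⟨I, hI⟩ := eventually_atTop.mp (h (ε / 2) (half_pos hε))
    refine ⟨I, fun i hi => ?_⟩
    rw [dist_zero_right, norm_mul, Real.norm_of_nonneg (h0 i)]
    refine lt_of_le_of_lt ?_ (half_lt_self hε)
    have hb : ∀ k ∈ s i, ‖σ i‖ * ‖g i k‖ ≤ ε / 2 := fun k hk => by
      rw [← norm_smul]; exact hI i hi k hk
    by_cases hz : σ i = 0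
    · rw [hz, norm_zero, zero_mul]
      exact (half_pos hε).le
    · have h1 : ‖σ i‖ = 1 := by
        rcases hσ i with h | h | h
        · exact absurd h hz
        · rw [h]; simp
        · rw [Set.mem_singleton_iff.mp h]; simp
      rw [h1, one_mul]
      have : (s i).sup (fun k => ‖g i k‖₊) ≤ (⟨ε / 2, (half_pos hε).le⟩ : NNReal) :=
        Finset.sup_le fun k hk => by
          have := hb k hk
          rw [h1, one_mul] at this
          exact this
      exact this

section Blocks

variable {V : Type*} [NormedAddCommGroup V] [NormedSpace ℝ V] {D D₀ : ℕ → V} {N : ℕ → ℕ}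
  {σ η : ℕ → ℝ}

/-- At block ends, `D` differs from the signed sum of the increments of `D₀` by a sequence with
summable steps. Inside block `i` it oscillates like `σ i • D₀`, up to `η i → 0`. -/
theorem cauchySeq_iff_signed_blocks (hN : StrictMono N) (h0 : N 0 = 0)
    (hσ : ∀ i, σ i ∈ signValues) (hη : Summable η)
    (h : ∀ i, ∀ k ∈ Set.Icc (N i) (N (i + 1)), ∀ k' ∈ Set.Icc (N i) (N (i + 1)),
      ‖(D k - D k') - σ i • (D₀ k - D₀ k')‖ ≤ η i) :
    CauchySeq D ↔ CauchySeq (signedSum σ fun i => D₀ (N (i + 1)) - D₀ (N i)) ∧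
      Tendsto (fun i => σ i * finsetSupNorm (Finset.Icc (N i) (N (i + 1)))
        fun k => D₀ k - D₀ (N i)) atTop (𝓝 0) := by
  have hl : ∀ i, N i ∈ Set.Icc (N i) (N (i + 1)) := fun i => ⟨le_rfl, (hN (Nat.lt_succ_self i)).le⟩
  have hr : ∀ i, N (i + 1) ∈ Set.Icc (N i) (N (i + 1)) := fun i =>
    ⟨(hN (Nat.lt_succ_self i)).le, le_rfl⟩
  have hη0 := hη.tendsto_atTop_zero
  rw [tendsto_mul_finsetSupNorm_iff hσ (g := fun i k => D₀ k - D₀ (N i))]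
  have hG : CauchySeq fun I => D (N I) - signedSum σ (fun i => D₀ (N (i + 1)) - D₀ (N i)) I := by
    refine cauchySeq_of_summable_dist (Summable.of_nonneg_of_le (fun _ => dist_nonneg)
      (fun i => ?_) hη)
    rw [dist_comm, dist_eq_norm]
    refine le_trans (le_of_eq ?_) (h i _ (hr i) _ (hl i))
    rw [signedSum, signedSum, Finset.sum_range_succ]
    congr 1
    abel
  constructor
  · intro hD
    have hDN : CauchySeq fun I => D (N I) := hD.comp_tendsto hN.tendsto_atTop
    have hs := hDN.add (uniformContinuous_neg.comp_cauchySeq hG)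
    refine ⟨?_, fun ε hε => ?_⟩
    · convert hs using 1
      funext I
      simp
    obtain ⟨I, hI⟩ := Metric.cauchySeq_iff.mp hD (ε / 2) (half_pos hε)
    filter_upwards [eventually_ge_atTop I, hη0.eventually_le_const (half_pos hε)] with i hi hηi k hk
    have hk' := Finset.mem_Icc.mp hk
    have hIi : I ≤ N i := hi.trans (hN.id_le i)
    have h1 := hI k (hIi.trans hk'.1) (N i) hIi
    rw [dist_eq_norm] at h1
    have h2 := h i k hk' _ (hl i)
    calc ‖σ i • (D₀ k - D₀ (N i))‖
        = ‖(D k - D (N i)) - ((D k - D (N i)) - σ i • (D₀ k - D₀ (N i)))‖ := by congr 1; abel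
      _ ≤ ε / 2 + ε / 2 := (norm_sub_le _ _).trans (add_le_add h1.le (h2.trans hηi))
      _ = ε := add_halves ε
  · rintro ⟨hs, hosc⟩
    have hDN : CauchySeq fun I => D (N I) := by
      convert hs.add hG using 1
      funext I
      simp
    refine cauchySeq_of_blocks hN h0 hDN fun ε hε => ?_
    filter_upwards [hosc (ε / 2) (half_pos hε), hη0.eventually_le_const (half_pos hε)]
      with i hi hηi k hk
    have h1 := hi k (Finset.mem_Icc.mpr hk)
    have h2 := h i k hk _ (hl i)
    calc ‖D k - D (N i)‖
        = ‖σ i • (D₀ k - D₀ (N i)) + ((D k - D (N i)) - σ i • (D₀ k - D₀ (N i)))‖ := by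
          congr 1; abel
      _ ≤ ε / 2 + ε / 2 := (norm_add_le _ _).trans (add_le_add h1 (h2.trans hηi))
      _ = ε := add_halves ε

/-- The variant for the target `c₀`: single steps alone matter, so no series condition remains and
the largest step in a block takes the place of the oscillation. -/
theorem tendsto_steps_iff_signed_blocks (hN : StrictMono N) (h0 : N 0 = 0)
    (hσ : ∀ i, σ i ∈ signValues) (hη : Summable η)
    (h : ∀ i, ∀ k ∈ Set.Icc (N i) (N (i + 1)), ∀ k' ∈ Set.Icc (N i) (N (i + 1)),
      ‖(D k - D k') - σ i • (D₀ k - D₀ k')‖ ≤ η i) :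
    Tendsto (fun k => D (k + 1) - D k) atTop (𝓝 0) ↔
      Tendsto (fun i => σ i * finsetSupNorm (Finset.Ico (N i) (N (i + 1)))
        fun k => D₀ (k + 1) - D₀ k) atTop (𝓝 0) := by
  have hη0 := hη.tendsto_atTop_zero
  rw [tendsto_mul_finsetSupNorm_iff hσ (g := fun _ k => D₀ (k + 1) - D₀ k)]
  have hstep : ∀ i, ∀ k ∈ Finset.Ico (N i) (N (i + 1)),
      ‖(D (k + 1) - D k) - σ i • (D₀ (k + 1) - D₀ k)‖ ≤ η i := by
    intro i k hk
    obtain ⟨h1, h2⟩ := Finset.mem_Ico.mp hk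
    exact h i _ ⟨by omega, by omega⟩ _ ⟨h1, h2.le⟩
  constructor
  · intro hD ε hε
    obtain ⟨I, hI⟩ := Metric.tendsto_atTop.mp hD (ε / 2) (half_pos hε)
    filter_upwards [eventually_ge_atTop I, hη0.eventually_le_const (half_pos hε)] with i hi hηi k hk
    have h1 := hI k ((hi.trans (hN.id_le i)).trans (Finset.mem_Ico.mp hk).1)
    rw [dist_zero_right] at h1
    have h2 := hstep i k hk
    calc ‖σ i • (D₀ (k + 1) - D₀ k)‖
        = ‖(D (k + 1) - D k) - ((D (k + 1) - D k) - σ i • (D₀ (k + 1) - D₀ k))‖ := by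
          congr 1; abel
      _ ≤ ε / 2 + ε / 2 := (norm_sub_le _ _).trans (add_le_add h1.le (h2.trans hηi))
      _ = ε := add_halves ε
  · intro hs
    refine Metric.tendsto_atTop.mpr fun ε hε => ?_
    obtain ⟨I, hI⟩ := eventually_atTop.mp
      ((hs (ε / 3) (by positivity)).and (hη0.eventually_le_const (show 0 < ε / 3 by positivity)))
    refine ⟨N I, fun k hk => ?_⟩
    obtain ⟨i, hi1, hi2⟩ := hN.exists_block h0 k
    have hIi : I ≤ i := Nat.lt_succ_iff.mp (hN.lt_iff_lt.mp (hk.trans_lt hi2))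
    obtain ⟨h1, h2⟩ := hI i hIi
    have h1 := h1 k (Finset.mem_Ico.mpr ⟨hi1, hi2⟩)
    have h3 := hstep i k (Finset.mem_Ico.mpr ⟨hi1, hi2⟩)
    rw [dist_zero_right]
    calc ‖D (k + 1) - D k‖ = ‖σ i • (D₀ (k + 1) - D₀ k) +
          ((D (k + 1) - D k) - σ i • (D₀ (k + 1) - D₀ k))‖ := by congr 1; abel
      _ ≤ ε / 3 + ε / 3 := (norm_add_le _ _).trans (add_le_add h1 (h3.trans h2))
      _ < ε := by linarith

end Blocks

/-! ### Weighted bits -/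

/-- The difference of two points of the Cantor space as a sequence of signs. -/
noncomputable def bitDiff (x y : ℕ → Bool) (n : ℕ) : ℝ :=
  (if x n then 1 else 0) - if y n then 1 else 0

/-- Weights on the rows of `ℕ`, such that each weight `2^(-q)` occurs infinitely often in each
row. -/
noncomputable def rowWeight (m n : ℕ) : ℝ := (1 / 2) ^ (Nat.unpair (n / (m + 1))).1

noncomputable def weightVec (m n : ℕ) : Fin (m + 1) → ℝ := rowWeight m n • rowVec (m + 1) n

theorem exists_weightVec_eq {m : ℕ} (r : Fin (m + 1)) (q K : ℕ) :
    ∃ i ≥ K, weightVec m i = Pi.single r ((1 / 2) ^ q) := by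
  have hmod : ((m + 1) * Nat.pair q K + r) % (m + 1) = r := by
    rw [Nat.mul_add_mod, Nat.mod_eq_of_lt r.2]
  have hdiv : ((m + 1) * Nat.pair q K + r) / (m + 1) = Nat.pair q K := by
    rw [Nat.mul_add_div (Nat.succ_pos m), Nat.div_eq_of_lt r.2, add_zero]
  refine ⟨(m + 1) * Nat.pair q K + r, ?_, ?_⟩
  · have := Nat.right_le_pair q K
    nlinarith
  · ext c
    rw [weightVec, rowWeight, hdiv, Nat.unpair_pair, Pi.smul_apply, rowVec, hmod, Pi.single_apply]
    by_cases h : c = r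
    · simp [h]
    · simp [h, Fin.val_ne_of_ne h]

/-- The point of `ℝ^ℕ` with the weighted bits of `x` as coordinates. -/
noncomputable def weightedBits (m : ℕ) (x : ℕ → Bool) (n : ℕ) : ℝ :=
  (if x n then 1 else 0) * rowWeight m n

theorem measurable_weightedBits (m : ℕ) : Measurable (weightedBits m) :=
  measurable_pi_iff.mpr fun n =>
    (measurable_from_top (f := fun b : Bool => (if b then 1 else 0) * rowWeight m n)).comp
      (measurable_pi_apply n)

theorem weightedBits_sub_mem_csFin_iff {m : ℕ} (x y : ℕ → Bool) :
    weightedBits m x - weightedBits m y ∈ csFin (m + 1) ↔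
      CauchySeq (signedSum (bitDiff x y) (weightVec m)) := by
  rw [mem_csFin_iff (Nat.le_add_left 1 m)]
  have : signedSum (weightedBits m x - weightedBits m y) (rowVec (m + 1)) =
      signedSum (bitDiff x y) (weightVec m) := by
    funext n
    refine Finset.sum_congr rfl fun i _ => ?_
    rw [weightVec, smul_smul, Pi.sub_apply, weightedBits, weightedBits, bitDiff, sub_mul]
  rw [this]

/-- A Borel map from the Cantor space to sequences that reduces convergence of signed weighted
series to convergence is, on a suitable copy of the Cantor space, close to a signed sum of
blocks. -/
theorem exists_signed_blocks {m : ℕ} {V : Type*} [NormedAddCommGroup V] [NormedSpace ℝ V]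
    [SecondCountableTopology V] [MeasurableSpace V] [OpensMeasurableSpace V]
    {S : (ℕ → Bool) → ℕ → V} (hS : ∀ k, Measurable fun x => S x k)
    (hrel : ∀ x y, CauchySeq (signedSum (bitDiff x y) (weightVec m)) ↔
      CauchySeq fun k => S x k - S y k) :
    ∃ (D₀ : ℕ → V) (N : ℕ → ℕ), StrictMono N ∧ N 0 = 0 ∧
      ∀ σ : ℕ → ℝ, (∀ i, σ i ∈ signValues) → ∃ x y,
        (CauchySeq (signedSum σ (weightVec m)) ↔ CauchySeq fun k => S x k - S y k) ∧
        ∀ i, ∀ k ∈ Set.Icc (N i) (N (i + 1)), ∀ k' ∈ Set.Icc (N i) (N (i + 1)),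
          ‖((S x k - S y k) - (S x k' - S y k')) - σ i • (D₀ k - D₀ k')‖ ≤ 2 * (1 / 2) ^ i := by
  have hfin : ∀ x y : ℕ → Bool, (∀ᶠ n in atTop, x n = y n) →
      CauchySeq fun k => S x k - S y k := by
    intro x y hxy
    rw [← hrel]
    obtain ⟨n₀, hn₀⟩ := eventually_atTop.mp hxy
    refine Tendsto.cauchySeq (x := signedSum (bitDiff x y) (weightVec m) n₀)
      (tendsto_const_nhds.congr' ?_)
    filter_upwards [eventually_ge_atTop n₀] with n hn
    refine (signedSum_eq_of_ge _ (fun i hi => ?_) hn).symm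
    by_contra hlt
    exact hi (by simp [bitDiff, hn₀ i (not_lt.mp hlt)])
  -- Choosing `j i` among the places with the weight vector of `i` leaves the weighted series
  -- unchanged on the copy of the Cantor space.
  have hpos : ∀ i, {n | weightVec m n = weightVec m i}.Infinite := by
    intro i
    refine Set.infinite_of_forall_exists_gt fun a => ?_
    have hi : i % (m + 1) < m + 1 := Nat.mod_lt _ (Nat.succ_pos m)
    obtain ⟨n, hn, hv⟩ := exists_weightVec_eq ⟨i % (m + 1), hi⟩
      (Nat.unpair (i / (m + 1))).1 (a + 1)
    refine ⟨n, ?_, hn⟩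
    rw [Set.mem_ofPred_eq, hv]
    ext c
    rw [weightVec, rowWeight, Pi.smul_apply, rowVec, Pi.single_apply]
    by_cases h : (c : ℕ) = i % (m + 1)
    · simp [h, Fin.ext_iff]
    · simp [h, Fin.ext_iff]
  obtain ⟨b, j, N, hj, hjpos, hN, h0, hblock⟩ := exists_block_decomposition hS hfin hpos
    (ε := fun i => (1 / 2) ^ i) fun i => by positivity
  let e : (ℕ → Bool) → ℕ → Bool := fun x => Function.extend j x b
  let o : ℕ → Bool := fun _ => true
  let z : ℕ → Bool := fun _ => false
  -- `D₀` is the response to switching on all free bits at once. On block `i` only bit `i` matters,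
  -- so it also gives, up to the error, the response to that bit alone.
  refine ⟨fun k => S (e o) k - S (e z) k, N, hN, h0, fun σ hσ => ?_⟩
  let x : ℕ → Bool := fun i => decide (σ i = 1)
  let y : ℕ → Bool := fun i => decide (σ i = -1)
  refine ⟨e x, e y, ?_, fun i k hk k' hk' => ?_⟩
  · rw [← hrel]
    have hxy : ∀ i, bitDiff (e x) (e y) (j i) = σ i := by
      intro i
      simp only [bitDiff, e, hj.injective.extend_apply, x, y, decide_eq_true_eq]
      rcases hσ i with h | h | h
      · rw [h]; norm_num
      · rw [h]; norm_num
      · rw [Set.mem_singleton_iff.mp h]; norm_num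
    have key := cauchySeq_sum_comp_iff hj (u := fun n => bitDiff (e x) (e y) n • weightVec m n)
      fun n hn => by simp [bitDiff, e, Function.extend_apply' _ _ _ hn]
    have hw : ∀ i, weightVec m (j i) = weightVec m i := hjpos
    simp only [hxy, hw] at key
    exact key.symm
  · have hb : ∀ x x', x i = x' i → ‖(S (e x) k - S (e x') k) - (S (e x) k' - S (e x') k')‖ ≤
        (1 / 2) ^ i := fun x x' h => hblock i x x' h k hk k' hk'
    have h2 : ∀ x' y', x i = x' i → y i = y' i →
        ‖((S (e x) k - S (e y) k) - (S (e x) k' - S (e y) k')) -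
          ((S (e x') k - S (e y') k) - (S (e x') k' - S (e y') k'))‖ ≤ 2 * (1 / 2) ^ i := by
      intro x' y' hx hy
      calc _ = ‖((S (e x) k - S (e x') k) - (S (e x) k' - S (e x') k')) -
            ((S (e y) k - S (e y') k) - (S (e y) k' - S (e y') k'))‖ := by congr 1; abel
        _ ≤ (1 / 2) ^ i + (1 / 2) ^ i :=
            (norm_sub_le _ _).trans (add_le_add (hb _ _ hx) (hb _ _ hy))
        _ = 2 * (1 / 2) ^ i := by ring
    rcases hσ i with h | h | h
    · have := h2 z z (by simp [x, z, h]) (by simp [y, z, h])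
      rw [h, zero_smul]
      simpa using this
    · have := h2 o z (by simp [x, o, h]) (by simp [y, z, h]; norm_num)
      rw [h, one_smul]
      exact this
    · have h := Set.mem_singleton_iff.mp h
      have := h2 z o (by simp [x, z, h]; norm_num) (by simp [y, o, h])
      rw [h, neg_smul, one_smul]
      refine le_trans (le_of_eq ?_) this
      congr 1
      beta_reduce
      abel

/-! ### Borel reducibility -/

theorem BorelReducible.trans {X Y Z : Type*} [TopologicalSpace X] [TopologicalSpace Y]
    [TopologicalSpace Z] {E : Setoid X} {F : Setoid Y} {G : Setoid Z} (h₁ : BorelReducible E F)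
    (h₂ : BorelReducible F G) : BorelReducible E G := by
  obtain ⟨θ, hθ, h⟩ := h₁
  obtain ⟨θ', hθ', h'⟩ := h₂
  exact ⟨θ' ∘ θ, hθ'.comp hθ, fun x y => (h x y).trans (h' _ _)⟩

theorem borelReducible_quotRel_iff {L L' : Submodule ℝ (ℕ → ℝ)} :
    BorelReducible (quotRel L) (quotRel L') ↔ ∃ θ : (ℕ → ℝ) → ℕ → ℝ, Measurable θ ∧
      ∀ a b, a - b ∈ L ↔ θ a - θ b ∈ L' := by
  unfold BorelReducible
  rw [← BorelSpace.measurable_eq (α := ℕ → ℝ)]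
  rfl

theorem borelReducible_of_linear {L L' : Submodule ℝ (ℕ → ℝ)} (θ : (ℕ → ℝ) → ℕ → ℝ)
    (hθ : Measurable θ) (hsub : ∀ a b, θ a - θ b = θ (a - b)) (h : ∀ a, a ∈ L ↔ θ a ∈ L') :
    BorelReducible (quotRel L) (quotRel L') :=
  borelReducible_quotRel_iff.mpr ⟨θ, hθ, fun a b => by rw [hsub, h]⟩

/-! ### Linear reductions -/

theorem csFin_le_csFin_succ {m : ℕ} (hm : 1 ≤ m) :
    BorelReducible (quotRel (csFin m)) (quotRel (csFin (m + 1))) := by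
  refine borelReducible_of_linear
    (fun a n => if n % (m + 1) < m then a (m * (n / (m + 1)) + n % (m + 1)) else 0)
    (measurable_pi_iff.mpr fun n => ?_) (fun a b => ?_) fun a => ?_
  · by_cases h : n % (m + 1) < m
    · simpa only [h, if_true] using measurable_pi_apply _
    · simp [h]
  · ext n
    by_cases h : n % (m + 1) < m <;> simp [h]
  · rw [mem_csFin_iff_rows hm, mem_csFin_iff_rows (Nat.le_add_left 1 m)]
    have hmod : ∀ r < m + 1, ∀ j, ((m + 1) * j + r) % (m + 1) = r := fun r hr j => by
      rw [Nat.mul_add_mod, Nat.mod_eq_of_lt hr]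
    have hdiv : ∀ r < m + 1, ∀ j, ((m + 1) * j + r) / (m + 1) = j := fun r hr j => by
      rw [Nat.mul_add_div (Nat.succ_pos m), Nat.div_eq_of_lt hr, add_zero]
    constructor
    · intro h r hr
      simp only [hmod r hr, hdiv r hr]
      by_cases hrm : r < m
      · simpa only [hrm, if_true] using h r hrm
      · simpa only [hrm, if_false, Finset.sum_const_zero] using cauchySeq_const 0
    · intro h r hr
      have hr' : r < m + 1 := hr.trans (Nat.lt_succ_self m)
      have := h r hr'
      simpa only [hmod r hr', hdiv r hr', hr, if_true] using this

theorem csFin_le_csInf {m : ℕ} (hm : 1 ≤ m) {p : ℕ × ℕ ≃ ℕ}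
    (hp : ∀ i : ℕ, StrictMono fun j : ℕ => p (i, j)) :
    BorelReducible (quotRel (csFin m)) (quotRel (csInf p)) := by
  refine borelReducible_of_linear
    (fun a n => if (p.symm n).1 < m then a (m * (p.symm n).2 + (p.symm n).1) else 0)
    (measurable_pi_iff.mpr fun n => ?_) (fun a b => ?_) fun a => ?_
  · by_cases h : (p.symm n).1 < m
    · simpa only [h, if_true] using measurable_pi_apply _
    · simp [h]
  · ext n
    by_cases h : (p.symm n).1 < m <;> simp [h]
  · rw [mem_csFin_iff_rows hm, mem_csInf_iff_rows hp (m := m)]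
    · refine forall₂_congr fun r hr => ?_
      simp [hr]
    · intro r hr j
      simp [hr]

/-- The partial sums telescope to 0 at even places and to `a (n / 2)` at odd ones, so the limit can
only be 0. -/
theorem cauchySeq_sum_alternating_iff {a : ℕ → ℝ} :
    CauchySeq (fun n => ∑ j ∈ Finset.range n, if j % 2 = 0 then a (j / 2) else -a (j / 2)) ↔
      Tendsto a atTop (𝓝 0) := by
  have hsum : ∀ n, ∑ j ∈ Finset.range n, (if j % 2 = 0 then a (j / 2) else -a (j / 2)) =
      if n % 2 = 0 then 0 else a (n / 2) := by
    intro n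
    induction n with
    | zero => simp
    | succ n ih =>
      rw [Finset.sum_range_succ, ih]
      rcases Nat.mod_two_eq_zero_or_one n with h | h
      · have h1 : (n + 1) % 2 ≠ 0 := by omega
        have h2 : (n + 1) / 2 = n / 2 := by omega
        simp [h, h1, h2]
      · have h1 : (n + 1) % 2 = 0 := by omega
        simp [h, h1]
  simp only [hsum]
  constructor
  · intro h
    obtain ⟨s, hs⟩ := cauchySeq_tendsto_of_complete h
    have ho : Tendsto (fun n : ℕ => 2 * n + 1) atTop atTop :=
      tendsto_atTop_mono (fun n => (by omega : n ≤ 2 * n + 1)) tendsto_id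
    have he : Tendsto (fun n : ℕ => 2 * n) atTop atTop :=
      tendsto_atTop_mono (fun n => (by omega : n ≤ 2 * n)) tendsto_id
    have h1 := hs.comp he
    have h2 := hs.comp ho
    have e1 : ((fun n => if n % 2 = 0 then 0 else a (n / 2)) ∘ fun n : ℕ => 2 * n) =
        fun _ => 0 := by funext n; simp
    have e2 : ((fun n => if n % 2 = 0 then 0 else a (n / 2)) ∘ fun n : ℕ => 2 * n + 1) = a := by
      funext n
      have h1 : (2 * n + 1) % 2 ≠ 0 := by omega
      have h2 : (2 * n + 1) / 2 = n := by omega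
      simp [h2]
    rw [e1] at h1
    rw [e2] at h2
    rwa [tendsto_nhds_unique h1 tendsto_const_nhds] at h2
  · intro h
    refine Tendsto.cauchySeq (x := 0) (squeeze_zero_norm (a := fun n => ‖a (n / 2)‖) (fun n => ?_) ?_)
    · by_cases hn : n % 2 = 0 <;> simp [hn]
    · exact (tendsto_zero_iff_norm_tendsto_zero.mp h).comp
        (Nat.tendsto_div_const_atTop two_ne_zero)

theorem c0Seq_le_csFin {m : ℕ} (hm : 1 ≤ m) :
    BorelReducible (quotRel c0Seq) (quotRel (csFin m)) := by
  refine borelReducible_of_linear (fun a n => if n % m = 0 then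
      (if n / m % 2 = 0 then a (n / m / 2) else -a (n / m / 2)) else 0)
    (measurable_pi_iff.mpr fun n => ?_) (fun a b => ?_) fun a => ?_
  · by_cases h : n % m = 0 <;> by_cases h' : n / m % 2 = 0
    · simpa only [h, h', if_true] using measurable_pi_apply _
    · simp only [h, h', if_true, if_false]
      exact (measurable_pi_apply _).neg
    all_goals simp [h]
  · ext n
    by_cases h : n % m = 0 <;> by_cases h' : n / m % 2 = 0 <;> simp [h, h']
    ring
  · rw [mem_csFin_iff_rows hm]
    have hmod : ∀ r < m, ∀ j, (m * j + r) % m = r := fun r hr j => by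
      rw [Nat.mul_add_mod, Nat.mod_eq_of_lt hr]
    have hdiv : ∀ r < m, ∀ j, (m * j + r) / m = j := fun r hr j => by
      rw [Nat.mul_add_div hm, Nat.div_eq_of_lt hr, add_zero]
    refine Iff.trans cauchySeq_sum_alternating_iff.symm ⟨fun h r hr => ?_, fun h => ?_⟩
    · simp only [hmod r hr, hdiv r hr]
      by_cases h0 : r = 0
      · simpa only [h0, if_true] using h
      · simpa only [h0, if_false, Finset.sum_const_zero] using cauchySeq_const 0
    · have := h 0 hm
      simpa only [hmod 0 hm, hdiv 0 hm, if_true] using this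

/-! ### Non-reducibility -/

theorem not_csFin_succ_le_csFin {m : ℕ} (hm : 1 ≤ m) :
    ¬ BorelReducible (quotRel (csFin (m + 1))) (quotRel (csFin m)) := by
  rw [borelReducible_quotRel_iff]
  rintro ⟨θ, hθ, h⟩
  have hmeas : ∀ n, Measurable fun x => θ (weightedBits m x) n := fun n =>
    (measurable_pi_apply n).comp (hθ.comp (measurable_weightedBits m))
  obtain ⟨D₀, N, hN, h0, hσ⟩ := exists_signed_blocks (m := m)
    (S := fun x => signedSum (θ (weightedBits m x)) (rowVec m))
    (fun k => Finset.measurable_sum _ fun i _ => (hmeas i).smul_const _) fun x y => by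
      rw [← weightedBits_sub_mem_csFin_iff, h, mem_csFin_iff hm]
      have : signedSum (θ (weightedBits m x) - θ (weightedBits m y)) (rowVec m) =
          fun k => signedSum (θ (weightedBits m x)) (rowVec m) k -
            signedSum (θ (weightedBits m y)) (rowVec m) k := by
        funext k
        simp [signedSum, sub_smul]
      rw [this]
  refine not_signedReduction exists_weightVec_eq (v := fun i => D₀ (N (i + 1)) - D₀ (N i))
    (w := fun i => finsetSupNorm (Finset.Icc (N i) (N (i + 1))) fun k => D₀ k - D₀ (N i))
    fun σ hsig => ?_
  obtain ⟨x, y, hc, hb⟩ := hσ σ hsig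
  rw [hc]
  exact cauchySeq_iff_signed_blocks (η := fun i => 2 * (1 / 2) ^ i) hN h0 hsig
    (summable_geometric_two.mul_left 2) hb

theorem not_csFin_one_le_c0Seq : ¬ BorelReducible (quotRel (csFin 1)) (quotRel c0Seq) := by
  rw [borelReducible_quotRel_iff]
  rintro ⟨θ, hθ, h⟩
  -- Interleaving with zeros turns convergence of a difference to 0 into the Cauchy property, as the
  -- block decomposition requires, and makes every step of `S x` a value of `θ` up to sign.
  let S : (ℕ → Bool) → ℕ → ℝ := fun x k =>
    if k % 2 = 0 then θ (weightedBits 0 x) (k / 2) else 0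
  have hmeas : ∀ k, Measurable fun x => S x k := by
    intro k
    by_cases hk : k % 2 = 0
    · simp only [S, hk, if_true]
      exact (measurable_pi_apply (k / 2)).comp (hθ.comp (measurable_weightedBits 0))
    · simp [S, hk]
  have hodd : ∀ x k, k % 2 ≠ 0 → S x k = 0 := fun x k hk => if_neg hk
  have hsteps : ∀ x y, (CauchySeq fun k => S x k - S y k) ↔
      Tendsto (fun k => (S x (k + 1) - S y (k + 1)) - (S x k - S y k)) atTop (𝓝 0) := by
    intro x y
    constructor
    · intro hc
      obtain ⟨s, hs⟩ := cauchySeq_tendsto_of_complete hc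
      simpa using ((tendsto_add_atTop_iff_nat 1).mpr hs).sub hs
    · intro ht
      refine Tendsto.cauchySeq (x := 0)
        (squeeze_zero_norm (fun k => ?_) (tendsto_zero_iff_norm_tendsto_zero.mp ht))
      by_cases hk : k % 2 = 0
      · rw [hodd x (k + 1) (by omega), hodd y (k + 1) (by omega)]
        simp [abs_sub_comm]
      · rw [hodd x k hk, hodd y k hk]
        simp
  have hrel : ∀ x y, CauchySeq (signedSum (bitDiff x y) (weightVec 0)) ↔
      CauchySeq fun k => S x k - S y k := by
    intro x y
    rw [← weightedBits_sub_mem_csFin_iff, h]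
    constructor
    · intro hc
      have hc : Tendsto (θ (weightedBits 0 x) - θ (weightedBits 0 y)) atTop (𝓝 0) := hc
      refine Tendsto.cauchySeq (x := 0) (squeeze_zero_norm (fun k => ?_)
        ((tendsto_zero_iff_norm_tendsto_zero.mp hc).comp
          (Nat.tendsto_div_const_atTop two_ne_zero)))
      by_cases hk : k % 2 = 0 <;> simp [S, hk]
    · intro hc
      obtain ⟨s, hs⟩ := cauchySeq_tendsto_of_complete hc
      have h1 := hs.comp (tendsto_atTop_mono (fun n : ℕ => (by omega : n ≤ 2 * n + 1)) tendsto_id)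
      have h2 := hs.comp (tendsto_atTop_mono (fun n : ℕ => (by omega : n ≤ 2 * n)) tendsto_id)
      have hs0 : s = 0 := by
        refine tendsto_nhds_unique h1 (tendsto_const_nhds.congr fun n => ?_)
        simp [hodd _ (2 * n + 1) (by omega)]
      rw [hs0] at h2
      refine (h2.congr fun n => ?_ :
        Tendsto (θ (weightedBits 0 x) - θ (weightedBits 0 y)) atTop (𝓝 0))
      simp [S]
  obtain ⟨D₀, N, hN, h0, hσ⟩ := exists_signed_blocks hmeas hrel
  -- In the zero space `Fin 0 → ℝ` the series condition is vacuous, so only the condition on `w` is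
  -- left.
  refine not_signedReduction (m := 0) exists_weightVec_eq (v := fun _ => 0)
    (w := fun i => finsetSupNorm (Finset.Ico (N i) (N (i + 1))) fun k => D₀ (k + 1) - D₀ k)
    fun σ hsig => ?_
  obtain ⟨x, y, hc, hb⟩ := hσ σ hsig
  have hv : CauchySeq (signedSum σ fun _ => (0 : Fin 0 → ℝ)) := by
    have : signedSum σ (fun _ => (0 : Fin 0 → ℝ)) = fun _ => 0 := Subsingleton.elim _ _
    rw [this]
    exact cauchySeq_const 0
  rw [hc, hsteps, and_iff_right hv]
  exact tendsto_steps_iff_signed_blocks (D := fun k => S x k - S y k)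
    (η := fun i => 2 * (1 / 2) ^ i) hN h0 hsig (summable_geometric_two.mul_left 2) hb

theorem csFin_one_le_csFin {m : ℕ} (hm : 1 ≤ m) :
    BorelReducible (quotRel (csFin 1)) (quotRel (csFin m)) := by
  induction m, hm using Nat.le_induction with
  | base => exact ⟨id, @measurable_id _ (borel _), fun _ _ => Iff.rfl⟩
  | succ m hm ih => exact ih.trans (csFin_le_csFin_succ hm)

theorem theorem5p9 (m : ℕ) (hm : 1 ≤ m)
    (p : ℕ × ℕ ≃ ℕ) (hp : ∀ i : ℕ, StrictMono (fun j : ℕ => p (i, j))) :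
    BorelReducible (quotRel (csFin m)) (quotRel (csFin (m + 1))) ∧
      StrictBorelReducible (quotRel c0Seq) (quotRel (csFin m)) ∧
      StrictBorelReducible (quotRel (csFin m)) (quotRel (csInf p)) :=
  ⟨csFin_le_csFin_succ hm,
    ⟨c0Seq_le_csFin hm, fun h => not_csFin_one_le_c0Seq ((csFin_one_le_csFin hm).trans h)⟩,
    ⟨csFin_le_csInf hm hp, fun h => not_csFin_succ_le_csFin hm
      ((csFin_le_csInf (Nat.le_add_left 1 m) hp).trans h)⟩⟩
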